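/- Let $n\in\mathbb{N}=\{1,2,\dots\}$, $I=\{1,\dots,n\}$, $E=[0,\infty)^n$ with the trace topology and trace Borel $\sigma$-algebra of $\mathbb{R}^n$, and $s\in(0,\infty)$. For $B\subset I$ put $E_+(B)=\{x\in E : \{i : x_i>0\}=B\}$ and $$\lambda_B^{n,s}=s^{\,n-\#B}\prod_{i\in B}dx_+^i\prod_{j\in I\setminus B}d\delta_0^j,\qquad m_{n,s}=\sum_{B\subset I}\lambda_B^{n,s},$$ where $dx_+^i$ is Lebesgue measure on $[0,\infty)$ and $\delta_0^j$ the Dirac measure at $0$ in the indicated coordinates. Let $\varrho:E\to\mathbb{R}$ satisfy: (1) $\varrho>0$ $m_{n,s}$-a.e. and $\varrho\in L^1(E;m_{n,s})$; (2) (Hamza condition) for every $\varnothing\neq B\subset I$, $\varrho=0$ holds $\lambda_B^{n,s}$-a.e. on $\overline{E_+(B)}\setminus R_\varrho(\overline{E_+(B)})$, where $R_\varrho(\overline{E_+(B)})$ is the set of all $x\in\overline{E_+(B)}$ such that $\int_{\{y\in\overline{E_+(B)} : |x-y|\le\varepsilon\}}\varrho^{-1}\,d\lambda_B^{n,s}<\infty$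 for some $\varepsilon>0$. Put $\mu_{n,s,\varrho}=\varrho\,m_{n,s}$ and $\mu_B^{\varrho,n,s}=\varrho\,\lambda_B^{n,s}$. Let $C_c^2(E)$ be the set of continuous functions $f:E\to\mathbb{R}$ with compact support in $E$ which are twice continuously differentiable on $(0,\infty)^n$ and whose partial derivatives up to order two extend continuously from $(0,\infty)^n$ to $E$; $\partial_i f$ also denotes the continuous extension to $E$. Then $$\mathcal{E}(f,g)=\sum_{\varnothing\neq B\subset I}\ \sum_{i\in B}\int_{E_+(B)}\partial_i f\,\partial_i g\,d\mu_B^{\varrho,n,s},\qquad f,g\in C_c^2(E),$$ is a well-defined, densely defined, symmetric, positive (that is, $\mathcal{E}(f,f)\ge 0$) bilinear form on $L^2(E;\mu_{n,s,\varrho})$, and it is closable: if $f_k\in C_c^2(E)$, $\mathcal{E}(f_k-f_l,f_k-f_l)\to0$ as $k,l\to\infty$ and $f_k\to0$ in $L^2(E;\mu_{n,s,\varrho})$, then $\mathcal{E}(f_k,f_k)\to0$. Its closure $(\mathcal{E},D(\mathcal{E}))$, i.e. the closed extension in which $C_c^2(E)$ is dense with respect to $\mathcal{E}_1(u,u):=\mathcal{E}(u,u)+\|u\|_{L^2}^2$,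 is a symmetric Dirichlet form on $L^2(E;\mu_{n,s,\varrho})$ (a densely defined, positive, symmetric, closed form such that for $u\in D(\mathcal{E})$ the function $v=(0\vee u)\wedge1$ is in $D(\mathcal{E})$ and $\mathcal{E}(v,v)\le\mathcal{E}(u,u)$) which is * regular: $D(\mathcal{E})\cap C_c(E)$ is dense in $D(\mathcal{E})$ with respect to $\mathcal{E}_1$ and dense in $C_c(E)$ with respect to the supremum norm; * strongly local: $\mathcal{E}(u,v)=0$ for all $u,v\in D(\mathcal{E})$ with compact supports such that $v$ is constant a.e. on a neighbourhood of the support of $u$ (the support of $u$ being that of the measure $|u|\,\mu_{n,s,\varrho}$); * conservative: $T_t1=1$ for all $t>0$, where $(T_t)_{t>0}$ is the strongly continuous contraction semigroup on $L^2(E;\mu_{n,s,\varrho})$ associated with $(\mathcal{E},D(\mathcal{E}))$. -/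

import Mathlib

open MeasureTheory Filter Topology
open scoped ENNReal

noncomputable section

/-! ### Bilinear forms with a domain in a real Hilbert space -/

/-- A real bilinear form defined on a linear subspace of `H`. -/
structure PartialForm (H : Type*) [NormedAddCommGroup H] [InnerProductSpace ℝ H] where
  dom : Submodule ℝ H
  form : dom →ₗ[ℝ] dom →ₗ[ℝ] ℝ

namespace PartialForm

section Hilbert

variable {H : Type*} [NormedAddCommGroup H] [InnerProductSpace ℝ H]

def IsDenselyDefined (F : PartialForm H) : Prop := Dense (F.dom : Set H)

def IsSymmetric (F : PartialForm H) : Prop := ∀ u v : F.dom, F.form u v = F.form v u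

/-- Positive definite in the weak sense customary for Dirichlet forms: `F(u,u) ≥ 0`. -/
def IsPositive (F : PartialForm H) : Prop := ∀ u : F.dom, 0 ≤ F.form u u

/-- `F₁(u,u) = F(u,u) + (u,u)`. -/
def energyOne (F : PartialForm H) (u : F.dom) : ℝ := F.form u u + ‖(u : H)‖ ^ 2

def IsClosable (F : PartialForm H) : Prop :=
  ∀ u : ℕ → F.dom,
    (∀ ε > (0 : ℝ), ∃ N, ∀ k ≥ N, ∀ l ≥ N, F.form (u k - u l) (u k - u l) < ε) →
    Tendsto (fun k => (u k : H)) atTop (𝓝 0) →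
    Tendsto (fun k => F.form (u k) (u k)) atTop (𝓝 0)

/-- The domain is complete with respect to `F₁`. -/
def IsClosed (F : PartialForm H) : Prop :=
  ∀ u : ℕ → F.dom,
    (∀ ε > (0 : ℝ), ∃ N, ∀ k ≥ N, ∀ l ≥ N, F.energyOne (u k - u l) < ε) →
    ∃ w : F.dom, Tendsto (fun k => F.energyOne (u k - w)) atTop (𝓝 0)

/-- `G` is the closure of `F`: the closed extension of `F` in which the domain of `F` is dense
with respect to `G₁`. -/
def IsClosureOf (G F : PartialForm H) : Prop :=
  G.IsClosed ∧
  ∃ h : F.dom ≤ G.dom,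
    (∀ u v : F.dom,
      G.form (Submodule.inclusion h u) (Submodule.inclusion h v) = F.form u v) ∧
    ∀ w : G.dom, ∀ ε > (0 : ℝ), ∃ u : F.dom, G.energyOne (w - Submodule.inclusion h u) < ε

/-- `w = G_β f`, where `(G_β)` is the resolvent of the form: `w` lies in the domain and
`F(w,v) + β (w,v) = (f,v)` for all `v` in the domain. -/
def IsResolventValue (F : PartialForm H) (β : ℝ) (f w : H) : Prop :=
  ∃ hw : w ∈ F.dom, ∀ v : F.dom,
    F.form ⟨w, hw⟩ v + β * inner ℝ w (v : H) = inner ℝ f (v : H)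

open Classical in
/-- The resolvent `G_β`. For a closed positive symmetric form and `β > 0`, existence and
uniqueness of `G_β f` hold for every `f`. -/
def resolvent (F : PartialForm H) (β : ℝ) (f : H) : H :=
  if h : ∃ w, F.IsResolventValue β f w then h.choose else 0

/-- The approximation `e^{-tβ} ∑ₖ (tβ)ᵏ / k! (β G_β)ᵏ f` of `T_t f`. -/
def semigroupApprox (F : PartialForm H) (t β : ℝ) (f : H) : H :=
  Real.exp (-(t * β)) •
    ∑' k : ℕ, ((t * β) ^ k / (k.factorial : ℝ)) • (fun g : H => β • F.resolvent β g)^[k] f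

/-- `w = T_t f`, where `(T_t)` is the strongly continuous contraction semigroup of the form,
given by the Hille-Yosida formula
`T_t f = lim_{β → ∞} e^{-tβ} ∑ₖ (tβ)ᵏ / k! (β G_β)ᵏ f`. -/
def IsSemigroupValue (F : PartialForm H) (t : ℝ) (f w : H) : Prop :=
  Tendsto (fun β : ℝ => F.semigroupApprox t β f) atTop (𝓝 w)

end Hilbert

/-! ### Dirichlet forms on `L²(X; μ)` -/

section Dirichlet

variable {X : Type*} [MeasurableSpace X] {μ : Measure X}

/-- The unit contraction `u ↦ (0 ∨ u) ∧ 1` operates on the form. -/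
def IsMarkovian (F : PartialForm (Lp ℝ 2 μ)) : Prop :=
  ∀ (u : F.dom) (v : Lp ℝ 2 μ),
    (v =ᵐ[μ] fun x => min (max ((u : Lp ℝ 2 μ) x) 0) 1) →
    ∃ hv : v ∈ F.dom, F.form ⟨v, hv⟩ ⟨v, hv⟩ ≤ F.form u u

structure IsSymmetricDirichletForm (F : PartialForm (Lp ℝ 2 μ)) : Prop where
  dense : F.IsDenselyDefined
  symm : F.IsSymmetric
  pos : F.IsPositive
  closed : F.IsClosed
  markov : F.IsMarkovian

/-- Conservativity on a finite measure space: `T_t 1 = 1` for all `t > 0`. -/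
def IsConservative (F : PartialForm (Lp ℝ 2 μ)) : Prop :=
  ∃ e : Lp ℝ 2 μ, (e =ᵐ[μ] fun _ => (1 : ℝ)) ∧ ∀ t : ℝ, 0 < t → F.IsSemigroupValue t e e

variable [TopologicalSpace X]

/-- `dom F ∩ C_c(X)` is dense in `dom F` with respect to `F₁`, and dense in `C_c(X)` with respect
to the supremum norm. -/
def IsRegular (F : PartialForm (Lp ℝ 2 μ)) : Prop :=
  (∀ u : F.dom, ∀ ε > (0 : ℝ), ∃ v : F.dom,
    (∃ g : X → ℝ, Continuous g ∧ HasCompactSupport g ∧ (v : Lp ℝ 2 μ) =ᵐ[μ] g) ∧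
      F.energyOne (u - v) < ε) ∧
  (∀ f : X → ℝ, Continuous f → HasCompactSupport f → ∀ ε > (0 : ℝ), ∃ g : X → ℝ,
    Continuous g ∧ HasCompactSupport g ∧ (∃ v : F.dom, (v : Lp ℝ 2 μ) =ᵐ[μ] g) ∧
      ∀ x, |f x - g x| < ε)

/-- The support of `u ∈ L²(X; μ)`: the support of the measure `|u| μ`. -/
def lpSupport (u : Lp ℝ 2 μ) : Set X := (μ.withDensity fun x => ‖u x‖ₑ).support

/-- `F(u,v) = 0` whenever `u`, `v` have compact support and `v` is constant on a neighbourhood of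
the support of `u`. -/
def IsStronglyLocal (F : PartialForm (Lp ℝ 2 μ)) : Prop :=
  ∀ u v : F.dom, IsCompact (lpSupport (u : Lp ℝ 2 μ)) → IsCompact (lpSupport (v : Lp ℝ 2 μ)) →
    (∃ U : Set X, IsOpen U ∧ lpSupport (u : Lp ℝ 2 μ) ⊆ U ∧
      ∃ c : ℝ, ∀ᵐ x ∂μ.restrict U, (v : Lp ℝ 2 μ) x = c) →
    F.form u v = 0

end Dirichlet

end PartialForm

/-! ### The orthant, its faces and measures -/

/-- `E = [0,∞)ⁿ`, with the trace topology and trace Borel σ-algebra of `ℝⁿ`. -/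
abbrev Orthant (n : ℕ) : Type := {x : Fin n → ℝ // ∀ i, 0 ≤ x i}

namespace Orthant

variable {n : ℕ}

/-- `E₊(B)`: the points whose strictly positive coordinates are exactly those indexed by `B`. -/
def face (B : Finset (Fin n)) : Set (Orthant n) := {x | ∀ i, 0 < x.1 i ↔ i ∈ B}

/-- The interior `(0,∞)ⁿ`, as a subset of `E`. -/
def openOrthant (n : ℕ) : Set (Orthant n) := {x | ∀ i, 0 < x.1 i}

/-- Lebesgue measure on `[0,∞)` in the coordinates of `B`, Dirac measure at `0` in the others. -/
def faceMeasure (B : Finset (Fin n)) : Measure (Orthant n) :=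
  (Measure.pi fun i : Fin n =>
    if i ∈ B then (volume : Measure ℝ).restrict (Set.Ici 0) else Measure.dirac 0).comap
      Subtype.val

/-- `λ_B^{n,s} = s^{n - #B} λ_B^{(n)}`. -/
def scaledFaceMeasure (s : ℝ) (B : Finset (Fin n)) : Measure (Orthant n) :=
  ENNReal.ofReal (s ^ (n - B.card)) • faceMeasure B

/-- `m_{n,s} = ∑_B λ_B^{n,s}`, the sum over all subsets `B` of the index set. -/
def baseMeasure (n : ℕ) (s : ℝ) : Measure (Orthant n) :=
  ∑ B : Finset (Fin n), scaledFaceMeasure s B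

/-- `μ_{n,s,ϱ} = ϱ m_{n,s}`. -/
def refMeasure (s : ℝ) (ϱ : Orthant n → ℝ) : Measure (Orthant n) :=
  (baseMeasure n s).withDensity fun x => ENNReal.ofReal (ϱ x)

/-- `μ_B^{ϱ,n,s} = ϱ λ_B^{n,s}`. -/
def weightedFaceMeasure (s : ℝ) (ϱ : Orthant n → ℝ) (B : Finset (Fin n)) :
    Measure (Orthant n) :=
  (scaledFaceMeasure s B).withDensity fun x => ENNReal.ofReal (ϱ x)

/-- The closed Euclidean ball around `x` of radius `ε` in the closure of `E₊(B)`. -/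
def faceBall (B : Finset (Fin n)) (x : Orthant n) (ε : ℝ) : Set (Orthant n) :=
  {y | y ∈ closure (face B) ∧ Real.sqrt (∑ i, (x.1 i - y.1 i) ^ 2) ≤ ε}

/-- The points of the closure of `E₊(B)` near which `1 / ϱ` is `λ_B^{n,s}`-integrable. -/
def regularSet (s : ℝ) (ϱ : Orthant n → ℝ) (B : Finset (Fin n)) : Set (Orthant n) :=
  {x | x ∈ closure (face B) ∧ ∃ ε > (0 : ℝ),
    ∫⁻ y in faceBall B x ε, (ENNReal.ofReal (ϱ y))⁻¹ ∂(scaledFaceMeasure s B) < ∞}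

/-- The Hamza condition on every face of positive dimension. -/
def HamzaCondition (s : ℝ) (ϱ : Orthant n → ℝ) : Prop :=
  ∀ B : Finset (Fin n), B.Nonempty →
    ∀ᵐ x ∂(scaledFaceMeasure s B), x ∈ closure (face B) \ regularSet s ϱ B → ϱ x = 0

/-! ### The function space `C_c^2(E)` and the form -/

/-- The function on `ℝⁿ` equal to `f` on `E` and to `0` elsewhere; only its restriction to the
open set `(0,∞)ⁿ` is used. -/
def toAmbient (f : Orthant n → ℝ) : (Fin n → ℝ) → ℝ := Function.extend Subtype.val f 0

/-- The partial derivative `∂_i F`. -/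
def partialDeriv (i : Fin n) (F : (Fin n → ℝ) → ℝ) : (Fin n → ℝ) → ℝ :=
  fun x => lineDeriv ℝ F x (Pi.single i 1)

/-- The restriction of `F` to `(0,∞)ⁿ` has a continuous extension to `E`. -/
def ExtendsContinuously (F : (Fin n → ℝ) → ℝ) : Prop :=
  ∃ g : Orthant n → ℝ, Continuous g ∧ ∀ x ∈ openOrthant n, g x = F x.1

/-- `f ∈ C_c^2(E)`: `f` is continuous on `E` with compact support, `C²` in `(0,∞)ⁿ`, and its
partial derivatives of order one and two extend continuously from `(0,∞)ⁿ` to `E`. -/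
structure IsC2c (f : Orthant n → ℝ) : Prop where
  cont : Continuous f
  supp : HasCompactSupport f
  contDiffOn : ContDiffOn ℝ 2 (toAmbient f) {x | ∀ i, 0 < x i}
  ext_one : ∀ i, ExtendsContinuously (partialDeriv i (toAmbient f))
  ext_two : ∀ i j, ExtendsContinuously (partialDeriv i (partialDeriv j (toAmbient f)))

/-- `∂_i f` on all of `E`: the extension by continuity of the partial derivative on `(0,∞)ⁿ`. -/
def pderiv (i : Fin n) (f : Orthant n → ℝ) : Orthant n → ℝ :=
  extendFrom (openOrthant n) fun x => partialDeriv i (toAmbient f) x.1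

/-- `E_B(f,g) = ∑_{i ∈ B} ∫_{E₊(B)} ∂_i f ∂_i g dμ_B^{ϱ,n,s}`. -/
def faceEnergy (s : ℝ) (ϱ : Orthant n → ℝ) (B : Finset (Fin n)) (f g : Orthant n → ℝ) : ℝ :=
  ∑ i ∈ B, ∫ x in face B, pderiv i f x * pderiv i g x ∂(weightedFaceMeasure s ϱ B)

open Classical in
/-- `E(f,g)`: the sum of `E_B(f,g)` over the nonempty subsets `B` of the index set. -/
def energy (s : ℝ) (ϱ : Orthant n → ℝ) (f g : Orthant n → ℝ) : ℝ :=
  ∑ B ∈ Finset.univ.filter (fun B : Finset (Fin n) => B.Nonempty), faceEnergy s ϱ B f g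

/-- `F` is the form `(E, C_c^2(E))` on `L²(E; μ_{n,s,ϱ})`: its domain consists of the classes of
the functions in `C_c^2(E)`, and its value at two classes is `E(f,g)` for any representatives
`f, g ∈ C_c^2(E)`. -/
structure IsEnergyForm (s : ℝ) (ϱ : Orthant n → ℝ)
    (F : PartialForm (Lp ℝ 2 (refMeasure s ϱ))) : Prop where
  memLp : ∀ f : Orthant n → ℝ, IsC2c f → MemLp f 2 (refMeasure s ϱ)
  mem_dom_iff : ∀ u : Lp ℝ 2 (refMeasure s ϱ),
    u ∈ F.dom ↔ ∃ f : Orthant n → ℝ, IsC2c f ∧ u =ᵐ[refMeasure s ϱ] f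
  integrable : ∀ f g : Orthant n → ℝ, IsC2c f → IsC2c g →
    ∀ B : Finset (Fin n), ∀ i ∈ B,
      IntegrableOn (fun x => pderiv i f x * pderiv i g x) (face B) (weightedFaceMeasure s ϱ B)
  form_eq : ∀ (u v : F.dom) (f g : Orthant n → ℝ), IsC2c f → IsC2c g →
    (u : Lp ℝ 2 (refMeasure s ϱ)) =ᵐ[refMeasure s ϱ] f →
    (v : Lp ℝ 2 (refMeasure s ϱ)) =ᵐ[refMeasure s ϱ] g →
    F.form u v = energy s ϱ f g

end Orthant

end

/-! The energy is the squared norm of a gradient. The faces `face B` with `i ∈ B` partition `{x | 0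
< x i}`, and on each of them the reference measure agrees with the weighted face measure. Regrouping
the sum by coordinates therefore gives E(f,g) = ∑ᵢ ∫_{xᵢ>0} ∂ᵢf ∂ᵢg dμ (`energy_eq`), an inner
product in the Hilbert sum `GradSpace`. Well-definedness on L²-classes, closability and the
existence of the closure then all follow from one fact: the closure of the graph of the gradient is
single-valued (`isSingleValued_closure_gradGraph`).

For that fact, let fₖ → 0 and ∂ᵢfₖ → h in the weighted L² spaces. Near a point where 1/ϱ is
integrable on a face, Cauchy-Schwarz turns this into unweighted L¹ convergence. Integration by parts
along the i-th coordinate (`integral_mul_pderiv`), against test functions supported in {yᵢ > 0},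
gives ∫ φ h = 0, so h = 0 there (`ae_face_eq_zero_near`). As ϱ > 0 a.e., the Hamza condition makes
almost every point of a face such a point, and countably many neighbourhoods suffice
(`ae_partMeasure_eq_zero`).

The remaining properties rest on a chain rule in the closure, for primitives of functions that are
pointwise limits of C¹ functions bounded by 1 (`HasGradient.comp_primitive_of_tendsto`). The
indicator of (0,1) yields the unit contraction, hence the Markov property. The indicator of {c} has
zero primitive, so by single-valuedness the gradient of u vanishes a.e. on {u = c}; strong locality
follows. Since μ is finite, dilated cutoff functions converge to 1 with gradients tending to 0, so 1
lies in the kernel of the closed form and is fixed by the semigroup. -/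

noncomputable section

/-! ### Forms of single-valued graphs in a product of Hilbert spaces. -/

namespace PartialForm

section Graph

variable {H K : Type*} [NormedAddCommGroup H] [InnerProductSpace ℝ H]
  [NormedAddCommGroup K] [InnerProductSpace ℝ K]

/-- The form `(u, v) ↦ (T u, T v)` of the operator `T` whose graph is `Γ`. -/
def ofGraph (Γ : Submodule ℝ (H × K)) : PartialForm H where
  dom := Γ.toLinearPMap.domain
  form := (innerₗ K).compl₁₂ Γ.toLinearPMap.toFun Γ.toLinearPMap.toFun

/-- `Γ` is the graph of a single-valued operator. -/
def IsSingleValued (Γ : Submodule ℝ (H × K)) : Prop := ∀ x ∈ Γ, x.1 = 0 → x.2 = 0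

variable {Γ : Submodule ℝ (H × K)}

lemma mem_dom_ofGraph {u : H} : u ∈ (ofGraph Γ).dom ↔ ∃ h : K, (u, h) ∈ Γ := by
  simp [ofGraph, Submodule.toLinearPMap_domain]

lemma IsSingleValued.unique (hΓ : IsSingleValued Γ) {u : H} {h h' : K} (hh : (u, h) ∈ Γ)
    (hh' : (u, h') ∈ Γ) : h = h' := by
  have := hΓ _ (Γ.sub_mem hh hh') (by simp)
  simpa [sub_eq_zero] using this

lemma IsSingleValued.mono {Γ' : Submodule ℝ (H × K)} (h : Γ ≤ Γ') (hΓ : IsSingleValued Γ') :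
    IsSingleValued Γ := fun x hx => hΓ x (h hx)

lemma exists_mem_graph (u : (ofGraph Γ).dom) :
    ∃ h : K, ((u : H), h) ∈ Γ := mem_dom_ofGraph.1 u.2

lemma IsSingleValued.form_eq (hΓ : IsSingleValued Γ) (u v : (ofGraph Γ).dom) {h k : K}
    (hu : ((u : H), h) ∈ Γ) (hv : ((v : H), k) ∈ Γ) :
    (ofGraph Γ).form u v = inner ℝ h k := by
  have e : ∀ (w : (ofGraph Γ).dom) (l : K), ((w : H), l) ∈ Γ → Γ.toLinearPMap w = l :=
    fun w l hl => hΓ.unique (Γ.mem_graph_toLinearPMap (fun x hx hx' => hΓ x hx hx') w) hl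
  change inner ℝ (Γ.toLinearPMap u) (Γ.toLinearPMap v) = _
  rw [e u h hu, e v k hv]

lemma IsSingleValued.energyOne_eq (hΓ : IsSingleValued Γ) (u : (ofGraph Γ).dom) {h : K}
    (hu : ((u : H), h) ∈ Γ) : (ofGraph Γ).energyOne u = ‖h‖ ^ 2 + ‖(u : H)‖ ^ 2 := by
  rw [energyOne, hΓ.form_eq u u hu hu, real_inner_self_eq_norm_sq]

lemma isSymmetric_ofGraph : (ofGraph Γ).IsSymmetric := fun _ _ => real_inner_comm _ _

lemma isPositive_ofGraph : (ofGraph Γ).IsPositive :=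
  fun u => real_inner_self_nonneg (x := Γ.toLinearPMap u)

/-- `energyOne` is the squared Hilbert norm on the graph, so completeness of the form domain is
completeness of a closed subspace of `H × K`. -/
lemma IsSingleValued.isClosed_ofGraph [CompleteSpace H] [CompleteSpace K]
    (hΓ : IsSingleValued Γ) (hc : _root_.IsClosed (Γ : Set (H × K))) : (ofGraph Γ).IsClosed := by
  intro u hu
  choose h hh using fun k => exists_mem_graph (u k)
  have hsub : ∀ k l, (((u k - u l : (ofGraph Γ).dom) : H), h k - h l) ∈ Γ :=
    fun k l => Γ.sub_mem (hh k) (hh l)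
  have hcau : ∀ ε > (0 : ℝ), ∃ N, ∀ k ≥ N, ∀ l ≥ N,
      ‖(u k : H) - u l‖ < ε ∧ ‖h k - h l‖ < ε := by
    intro ε hε
    obtain ⟨N, hN⟩ := hu (ε ^ 2) (by positivity)
    refine ⟨N, fun k hk l hl => ?_⟩
    have := hN k hk l hl
    rw [hΓ.energyOne_eq _ (hsub k l)] at this
    constructor
    · refine lt_of_pow_lt_pow_left₀ 2 hε.le (lt_of_le_of_lt ?_ this)
      simp
    · refine lt_of_pow_lt_pow_left₀ 2 hε.le (lt_of_le_of_lt ?_ this)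
      simp
  obtain ⟨a, ha⟩ := cauchySeq_tendsto_of_complete (u := fun k => (u k : H))
    (Metric.cauchySeq_iff.2 fun ε hε => by
      obtain ⟨N, hN⟩ := hcau ε hε
      exact ⟨N, fun k hk l hl => by simpa [dist_eq_norm] using (hN k hk l hl).1⟩)
  obtain ⟨b, hb⟩ := cauchySeq_tendsto_of_complete (u := h)
    (Metric.cauchySeq_iff.2 fun ε hε => by
      obtain ⟨N, hN⟩ := hcau ε hε
      exact ⟨N, fun k hk l hl => by simpa [dist_eq_norm] using (hN k hk l hl).2⟩)
  have hab : (a, b) ∈ Γ := hc.mem_of_tendsto (ha.prodMk_nhds hb) (Eventually.of_forall hh)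
  refine ⟨⟨a, mem_dom_ofGraph.2 ⟨b, hab⟩⟩, ?_⟩
  have : ∀ k, (ofGraph Γ).energyOne (u k - ⟨a, mem_dom_ofGraph.2 ⟨b, hab⟩⟩)
      = ‖h k - b‖ ^ 2 + ‖(u k : H) - a‖ ^ 2 :=
    fun k => hΓ.energyOne_eq _ (Γ.sub_mem (hh k) hab)
  simp_rw [this]
  have h1 := (hb.sub_const b).norm.pow 2
  have h2 := (ha.sub_const a).norm.pow 2
  simpa using h1.add h2

/-- The images `h k` are Cauchy; their limit `b` puts `(0, b)` in the closed graph, which forces `b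
= 0`. -/
lemma isClosable_ofGraph [CompleteSpace K] (hΓ : IsSingleValued Γ.topologicalClosure) :
    (ofGraph Γ).IsClosable := by
  have hΓ' : IsSingleValued Γ := hΓ.mono Γ.le_topologicalClosure
  intro u hu hu0
  choose h hh using fun k => exists_mem_graph (u k)
  have hcau : CauchySeq h := Metric.cauchySeq_iff.2 fun ε hε => by
    obtain ⟨N, hN⟩ := hu (ε ^ 2) (by positivity)
    refine ⟨N, fun k hk l hl => ?_⟩
    have := hN k hk l hl
    have hm : (((u k - u l : (ofGraph Γ).dom) : H), h k - h l) ∈ Γ := Γ.sub_mem (hh k) (hh l)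
    rw [hΓ'.form_eq _ _ hm hm, real_inner_self_eq_norm_sq] at this
    rw [dist_eq_norm]
    exact lt_of_pow_lt_pow_left₀ 2 hε.le this
  obtain ⟨b, hb⟩ := cauchySeq_tendsto_of_complete hcau
  have hab : ((0 : H), b) ∈ Γ.topologicalClosure :=
    Γ.isClosed_topologicalClosure.mem_of_tendsto (hu0.prodMk_nhds hb)
      (Eventually.of_forall fun k => Γ.le_topologicalClosure (hh k))
  have hb0 : b = 0 := hΓ _ hab rfl
  have : ∀ k, (ofGraph Γ).form (u k) (u k) = ‖h k‖ ^ 2 := fun k => by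
    rw [hΓ'.form_eq _ _ (hh k) (hh k), real_inner_self_eq_norm_sq]
  simp_rw [this]
  simpa [hb0] using hb.norm.pow 2

lemma isClosureOf_ofGraph [CompleteSpace H] [CompleteSpace K]
    (hΓ : IsSingleValued Γ.topologicalClosure) :
    (ofGraph Γ.topologicalClosure).IsClosureOf (ofGraph Γ) := by
  have hΓ' : IsSingleValued Γ := hΓ.mono Γ.le_topologicalClosure
  have hle : (ofGraph Γ).dom ≤ (ofGraph Γ.topologicalClosure).dom := fun u hu => by
    obtain ⟨h, hh⟩ := mem_dom_ofGraph.1 hu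
    exact mem_dom_ofGraph.2 ⟨h, Γ.le_topologicalClosure hh⟩
  refine ⟨hΓ.isClosed_ofGraph Γ.isClosed_topologicalClosure, hle, fun u v => ?_,
    fun w ε hε => ?_⟩
  · obtain ⟨h, hh⟩ := exists_mem_graph u
    obtain ⟨k, hk⟩ := exists_mem_graph v
    rw [hΓ'.form_eq u v hh hk, hΓ.form_eq _ _ (Γ.le_topologicalClosure hh)
      (Γ.le_topologicalClosure hk)]
  · obtain ⟨h, hh⟩ := exists_mem_graph w
    have hcl : ((w : H), h) ∈ closure (Γ : Set (H × K)) := hh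
    -- The product carries the sup metric, so each of the two squared components gets the share `ε /
    -- 2`.
    obtain ⟨x, hx, hxd⟩ := Metric.mem_closure_iff.1 hcl (Real.sqrt (ε / 2)) (by positivity)
    rw [Prod.dist_eq, max_lt_iff, dist_eq_norm, dist_eq_norm] at hxd
    refine ⟨⟨x.1, mem_dom_ofGraph.2 ⟨x.2, hx⟩⟩, ?_⟩
    rw [hΓ.energyOne_eq _ (h := h - x.2)
      (Γ.topologicalClosure.sub_mem hh (Γ.le_topologicalClosure hx))]
    have h1 := pow_lt_pow_left₀ hxd.1 (norm_nonneg _) two_ne_zero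
    have h2 := pow_lt_pow_left₀ hxd.2 (norm_nonneg _) two_ne_zero
    rw [Real.sq_sqrt (by positivity)] at h1 h2
    change ‖h - x.2‖ ^ 2 + ‖(w : H) - x.1‖ ^ 2 < ε
    linarith

end Graph

/-! ### Fixed vectors of the semigroup. -/

section Semigroup

variable {H : Type*} [NormedAddCommGroup H] [InnerProductSpace ℝ H]

/-- Testing the difference of the two resolvent equations with `w - w'` leaves a sum of two
nonnegative terms equal to zero. Uniqueness is what identifies the chosen value `resolvent` with an
explicit candidate. -/
lemma IsPositive.resolventValue_unique {F : PartialForm H} (hF : F.IsPositive) {β : ℝ}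
    (hβ : 0 < β) {f w w' : H} (hw : F.IsResolventValue β f w) (hw' : F.IsResolventValue β f w') :
    w = w' := by
  obtain ⟨hd, h⟩ := hw
  obtain ⟨hd', h'⟩ := hw'
  set a : F.dom := ⟨w, hd⟩
  set b : F.dom := ⟨w', hd'⟩
  have e := (h (a - b)).trans (h' (a - b)).symm
  have e2 : F.form (a - b) (a - b) + β * inner ℝ (w - w') (w - w') = 0 := by
    have : ((a - b : F.dom) : H) = w - w' := rfl
    rw [this] at e
    rw [LinearMap.map_sub₂, inner_sub_left]
    linarith
  rw [real_inner_self_eq_norm_sq] at e2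
  have := hF (a - b)
  have h0 : ‖w - w'‖ ^ 2 = 0 := by
    have := sq_nonneg ‖w - w'‖
    nlinarith
  simpa [sub_eq_zero] using h0

/-- If `e` lies in the kernel of the form, then the semigroup fixes `e`. -/
lemma IsPositive.isSemigroupValue_self {F : PartialForm H} (hF : F.IsPositive) (e : F.dom)
    (he : ∀ v : F.dom, F.form e v = 0) (t : ℝ) : F.IsSemigroupValue t (e : H) (e : H) := by
  have hres : ∀ β : ℝ, 0 < β → β • F.resolvent β (e : H) = (e : H) := by
    intro β hβ
    -- With no energy term, the resolvent equation reduces to β (w, v) = (e, v).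
    have hv : F.IsResolventValue β (e : H) (β⁻¹ • (e : H)) := by
      refine ⟨F.dom.smul_mem _ e.2, fun v => ?_⟩
      have : (⟨β⁻¹ • (e : H), F.dom.smul_mem _ e.2⟩ : F.dom) = β⁻¹ • e := rfl
      rw [this, map_smul, LinearMap.smul_apply, he, real_inner_smul_left]
      field_simp
      simp
    have hex : ∃ w, F.IsResolventValue β (e : H) w := ⟨_, hv⟩
    rw [resolvent, dif_pos hex, hF.resolventValue_unique hβ hex.choose_spec hv, smul_smul,
      mul_inv_cancel₀ hβ.ne', one_smul]
  -- For every β > 0 the approximation already equals `e`: all iterates are `e`, and the exponential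
  -- series cancels the prefactor.
  refine tendsto_const_nhds.congr' ?_
  filter_upwards [eventually_gt_atTop 0] with β hβ
  have hit : ∀ k : ℕ, (fun g : H => β • F.resolvent β g)^[k] (e : H) = e :=
    fun k => Function.iterate_fixed (hres β hβ) k
  have hs : HasSum (fun k : ℕ => (t * β) ^ k / (k.factorial : ℝ)) (Real.exp (t * β)) := by
    rw [Real.exp_eq_exp_ℝ]
    exact NormedSpace.expSeries_div_hasSum_exp (t * β)
  simp_rw [semigroupApprox, hit]
  rw [(hs.smul_const (e : H)).tsum_eq, smul_smul, ← Real.exp_add]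
  simp

end Semigroup

end PartialForm


/-! ### Calculus for functions in C_c²(E). -/

namespace Orthant

variable {n : ℕ}

/-- The open orthant, as a subset of the ambient space. -/
def posSet (n : ℕ) : Set (Fin n → ℝ) := {x | ∀ i, 0 < x i}

lemma isOpen_posSet : IsOpen (posSet n) := by
  simp only [posSet, Set.ofPred_forall]
  exact isOpen_iInter_of_finite fun i => isOpen_lt continuous_const (continuous_apply i)

lemma isClosed_orthant : IsClosed {x : Fin n → ℝ | ∀ i, 0 ≤ x i} := by
  simp only [Set.ofPred_forall]
  exact isClosed_iInter fun i => isClosed_le continuous_const (continuous_apply i)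

/-- The coordinatewise positive part, a retraction of the ambient space onto the orthant. -/
def proj (x : Fin n → ℝ) : Orthant n := ⟨fun i => max (x i) 0, fun _ => le_max_right _ _⟩

lemma continuous_proj : Continuous (proj (n := n)) := by
  unfold proj
  fun_prop

@[simp] lemma proj_coe (x : Orthant n) : proj x.1 = x := by
  ext i
  simp [proj, x.2 i]

lemma coe_proj_of_nonneg {x : Fin n → ℝ} (hx : ∀ i, 0 ≤ x i) : (proj x).1 = x := by
  ext i
  simp [proj, hx i]

lemma coe_proj_of_pos {x : Fin n → ℝ} (hx : x ∈ posSet n) : (proj x).1 = x :=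
  coe_proj_of_nonneg fun i => (hx i).le

@[simp] lemma toAmbient_coe (f : Orthant n → ℝ) (x : Orthant n) : toAmbient f x.1 = f x :=
  Subtype.val_injective.extend_apply _ _ _

lemma toAmbient_of_pos (f : Orthant n → ℝ) {x : Fin n → ℝ} (hx : x ∈ posSet n) :
    toAmbient f x = f (proj x) := by
  conv_lhs => rw [← coe_proj_of_pos hx]
  simp

lemma dense_openOrthant : Dense (openOrthant n) := by
  intro x
  have hc : Continuous fun t : ℝ => proj (fun i => x.1 i + t) := by
    apply continuous_proj.comp
    fun_prop
  have ht : Tendsto (fun t : ℝ => proj (fun i => x.1 i + t)) (𝓝[>] 0) (𝓝 x) := by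
    have := (hc.tendsto 0).mono_left (nhdsWithin_le_nhds (s := Set.Ioi 0))
    simpa using this
  refine mem_closure_of_tendsto ht ?_
  filter_upwards [self_mem_nhdsWithin] with t htp i
  have : 0 < x.1 i + t := add_pos_of_nonneg_of_pos (x.2 i) htp
  simpa [proj] using this

/-- A continuous extension from a dense set is unique; this is how the boundary values given by
`extendFrom` are computed throughout. -/
lemma pderiv_eq {f g : Orthant n → ℝ} {i : Fin n} (hg : Continuous g)
    (h : ∀ x ∈ openOrthant n, g x = partialDeriv i (toAmbient f) x.1) : pderiv i f = g := by
  ext x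
  refine extendFrom_eq (dense_openOrthant x) ?_
  refine ((hg.tendsto x).mono_left nhdsWithin_le_nhds).congr' ?_
  filter_upwards [self_mem_nhdsWithin] with y hy using h y hy

lemma IsC2c.continuous_pderiv {f : Orthant n → ℝ} (hf : IsC2c f) (i : Fin n) :
    Continuous (pderiv i f) := by
  obtain ⟨g, hg, h⟩ := hf.ext_one i
  rwa [pderiv_eq hg h]

lemma IsC2c.pderiv_apply {f : Orthant n → ℝ} (hf : IsC2c f) (i : Fin n) {x : Orthant n}
    (hx : x ∈ openOrthant n) : pderiv i f x = partialDeriv i (toAmbient f) x.1 := by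
  obtain ⟨g, hg, h⟩ := hf.ext_one i
  rw [pderiv_eq hg h, h x hx]

lemma partialDeriv_eq_fderiv {F : (Fin n → ℝ) → ℝ} {x : Fin n → ℝ} (hF : DifferentiableAt ℝ F x)
    (i : Fin n) : partialDeriv i F x = fderiv ℝ F x (Pi.single i 1) :=
  hF.lineDeriv_eq_fderiv

lemma partialDeriv_congr {F G : (Fin n → ℝ) → ℝ} (h : Set.EqOn F G (posSet n)) (i : Fin n) :
    Set.EqOn (partialDeriv i F) (partialDeriv i G) (posSet n) := fun _ hx =>
  Filter.EventuallyEq.lineDeriv_eq (h.eventuallyEq_of_mem (isOpen_posSet.mem_nhds hx))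

lemma differentiableAt_of_contDiffOn {F : (Fin n → ℝ) → ℝ} {m : WithTop ℕ∞} (hm : m ≠ 0)
    (hF : ContDiffOn ℝ m F (posSet n)) {x : Fin n → ℝ} (hx : x ∈ posSet n) :
    DifferentiableAt ℝ F x :=
  (hF.contDiffAt (isOpen_posSet.mem_nhds hx)).differentiableAt hm

lemma contDiffOn_partialDeriv {F : (Fin n → ℝ) → ℝ} (hF : ContDiffOn ℝ 2 F (posSet n))
    (i : Fin n) : ContDiffOn ℝ 1 (partialDeriv i F) (posSet n) := by
  have h1 : ContDiffOn ℝ 1 (fun x => fderiv ℝ F x (Pi.single i 1)) (posSet n) :=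
    (hF.fderiv_of_isOpen isOpen_posSet (by norm_num [one_add_one_eq_two])).clm_apply
      contDiffOn_const
  exact h1.congr fun x hx =>
    partialDeriv_eq_fderiv (differentiableAt_of_contDiffOn two_ne_zero hF hx) i

lemma partialDeriv_add {F G : (Fin n → ℝ) → ℝ} {x : Fin n → ℝ} (hF : DifferentiableAt ℝ F x)
    (hG : DifferentiableAt ℝ G x) (i : Fin n) :
    partialDeriv i (F + G) x = partialDeriv i F x + partialDeriv i G x := by
  rw [partialDeriv_eq_fderiv (hF.add hG), partialDeriv_eq_fderiv hF, partialDeriv_eq_fderiv hG,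
    fderiv_add hF hG, add_apply]

lemma partialDeriv_mul {F G : (Fin n → ℝ) → ℝ} {x : Fin n → ℝ} (hF : DifferentiableAt ℝ F x)
    (hG : DifferentiableAt ℝ G x) (i : Fin n) :
    partialDeriv i (F * G) x = F x * partialDeriv i G x + G x * partialDeriv i F x := by
  rw [partialDeriv_eq_fderiv (hF.mul hG), partialDeriv_eq_fderiv hF, partialDeriv_eq_fderiv hG,
    fderiv_mul hF hG]
  simp

lemma partialDeriv_comp {F : (Fin n → ℝ) → ℝ} {φ : ℝ → ℝ} {x : Fin n → ℝ}
    (hF : DifferentiableAt ℝ F x) (hφ : DifferentiableAt ℝ φ (F x)) (i : Fin n) :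
    partialDeriv i (φ ∘ F) x = deriv φ (F x) * partialDeriv i F x := by
  rw [partialDeriv_eq_fderiv (hφ.comp x hF), partialDeriv_eq_fderiv hF, fderiv_comp x hφ hF]
  simp [mul_comm]

/-- Criterion for membership in `C_c^2(E)`. -/
lemma isC2c_of_eqOn {f : Orthant n → ℝ} (hc : Continuous f) (hs : HasCompactSupport f)
    (hd : ContDiffOn ℝ 2 (toAmbient f) (posSet n)) (P : Fin n → (Fin n → ℝ) → ℝ)
    (hP : ∀ i, Set.EqOn (partialDeriv i (toAmbient f)) (P i) (posSet n))
    (hP1 : ∀ i, ExtendsContinuously (P i))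
    (hP2 : ∀ i j, ExtendsContinuously (partialDeriv i (P j))) : IsC2c f where
  cont := hc
  supp := hs
  contDiffOn := hd
  ext_one i := by
    obtain ⟨g, hg, h⟩ := hP1 i
    exact ⟨g, hg, fun x hx => (h x hx).trans (hP i hx).symm⟩
  ext_two i j := by
    obtain ⟨g, hg, h⟩ := hP2 i j
    exact ⟨g, hg, fun x hx => (h x hx).trans (partialDeriv_congr (hP j) i hx).symm⟩

lemma IsC2c.differentiableAt {f : Orthant n → ℝ} (hf : IsC2c f) {x : Fin n → ℝ}
    (hx : x ∈ posSet n) : DifferentiableAt ℝ (toAmbient f) x :=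
  differentiableAt_of_contDiffOn two_ne_zero hf.contDiffOn hx

lemma IsC2c.differentiableAt_partialDeriv {f : Orthant n → ℝ} (hf : IsC2c f) (i : Fin n)
    {x : Fin n → ℝ} (hx : x ∈ posSet n) :
    DifferentiableAt ℝ (partialDeriv i (toAmbient f)) x :=
  differentiableAt_of_contDiffOn one_ne_zero (contDiffOn_partialDeriv hf.contDiffOn i) hx

lemma toAmbient_add (f g : Orthant n → ℝ) : toAmbient (f + g) = toAmbient f + toAmbient g := by
  ext x
  by_cases hx : ∃ y : Orthant n, y.1 = x
  · obtain ⟨y, rfl⟩ := hx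
    simp
  · simp [toAmbient, Function.extend_apply' _ _ _ hx]

lemma toAmbient_comp {φ : ℝ → ℝ} (hφ : φ 0 = 0) (f : Orthant n → ℝ) :
    toAmbient (φ ∘ f) = φ ∘ toAmbient f := by
  ext x
  by_cases hx : ∃ y : Orthant n, y.1 = x
  · obtain ⟨y, rfl⟩ := hx
    simp
  · simp [toAmbient, Function.extend_apply' _ _ _ hx, hφ]

lemma IsC2c.add {f g : Orthant n → ℝ} (hf : IsC2c f) (hg : IsC2c g) : IsC2c (f + g) := by
  refine isC2c_of_eqOn (hf.cont.add hg.cont) (hf.supp.add hg.supp) ?_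
    (fun i => partialDeriv i (toAmbient f) + partialDeriv i (toAmbient g)) ?_ ?_ ?_
  · rw [toAmbient_add]
    exact hf.contDiffOn.add hg.contDiffOn
  · intro i x hx
    rw [toAmbient_add]
    exact partialDeriv_add (hf.differentiableAt hx) (hg.differentiableAt hx) i
  · intro i
    obtain ⟨a, ha, ha'⟩ := hf.ext_one i
    obtain ⟨b, hb, hb'⟩ := hg.ext_one i
    exact ⟨a + b, ha.add hb, fun x hx => by simp [ha' x hx, hb' x hx]⟩
  · intro i j
    obtain ⟨a, ha, ha'⟩ := hf.ext_two i j
    obtain ⟨b, hb, hb'⟩ := hg.ext_two i j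
    refine ⟨a + b, ha.add hb, fun x hx => ?_⟩
    rw [partialDeriv_add (hf.differentiableAt_partialDeriv j hx)
      (hg.differentiableAt_partialDeriv j hx) i]
    simp [ha' x hx, hb' x hx]

lemma IsC2c.comp {f : Orthant n → ℝ} (hf : IsC2c f) {φ : ℝ → ℝ} (hφ : ContDiff ℝ 2 φ)
    (hφ0 : φ 0 = 0) : IsC2c (φ ∘ f) := by
  have hφ' : ContDiff ℝ 1 (deriv φ) := by
    have : ContDiff ℝ (1 + 1) φ := by simpa [one_add_one_eq_two] using hφ
    exact (contDiff_succ_iff_deriv.1 this).2.2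
  have hφd : Differentiable ℝ φ := hφ.differentiable two_ne_zero
  have hφd' : Differentiable ℝ (deriv φ) := hφ'.differentiable one_ne_zero
  refine isC2c_of_eqOn (hφ.continuous.comp hf.cont) (hf.supp.comp_left hφ0) ?_
    (fun i => (deriv φ ∘ toAmbient f) * partialDeriv i (toAmbient f)) ?_ ?_ ?_
  · rw [toAmbient_comp hφ0]
    exact hφ.comp_contDiffOn hf.contDiffOn
  · intro i x hx
    rw [toAmbient_comp hφ0]
    exact partialDeriv_comp (hf.differentiableAt hx) (hφd _) i
  · intro i
    obtain ⟨a, ha, ha'⟩ := hf.ext_one i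
    exact ⟨fun x => deriv φ (f x) * a x, (hφ'.continuous.comp hf.cont).mul ha,
      fun x hx => by simp [ha' x hx]⟩
  · intro i j
    obtain ⟨a, ha, ha'⟩ := hf.ext_two i j
    obtain ⟨b, hb, hb'⟩ := hf.ext_one i
    obtain ⟨c, hc, hc'⟩ := hf.ext_one j
    refine ⟨fun x => deriv φ (f x) * a x + c x * (deriv (deriv φ) (f x) * b x),
      ((hφ'.continuous.comp hf.cont).mul ha).add (hc.mul
        (((hφ'.continuous_deriv le_rfl).comp hf.cont).mul hb)), fun x hx => ?_⟩
    rw [partialDeriv_mul ((hφd' _).comp _ (hf.differentiableAt hx))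
      (hf.differentiableAt_partialDeriv j hx) i,
      partialDeriv_comp (hf.differentiableAt hx) (hφd' _) i]
    simp [ha' x hx, hb' x hx, hc' x hx]

lemma IsC2c.smul {f : Orthant n → ℝ} (hf : IsC2c f) (c : ℝ) : IsC2c (c • f) :=
  hf.comp (φ := fun t => c * t) (by fun_prop) (by simp)

lemma IsC2c.zero : IsC2c (0 : Orthant n → ℝ) := by
  have hz : toAmbient (0 : Orthant n → ℝ) = fun _ => 0 := by
    ext x
    by_cases hx : ∃ y : Orthant n, y.1 = x
    · obtain ⟨y, rfl⟩ := hx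
      simp
    · simp [toAmbient, Function.extend_apply' _ _ _ hx]
  have hp : ∀ i : Fin n, partialDeriv i (fun _ : Fin n → ℝ => (0 : ℝ)) = fun _ => 0 := fun i => by
    ext x
    simp [partialDeriv, lineDeriv]
  refine ⟨continuous_const, HasCompactSupport.zero, ?_, fun i => ?_, fun i j => ?_⟩
  · rw [hz]
    exact contDiffOn_const
  · rw [hz, hp]
    exact ⟨0, continuous_const, fun _ _ => rfl⟩
  · rw [hz, hp, hp]
    exact ⟨0, continuous_const, fun _ _ => rfl⟩

lemma pderiv_add {f g : Orthant n → ℝ} (hf : IsC2c f) (hg : IsC2c g) (i : Fin n) :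
    pderiv i (f + g) = pderiv i f + pderiv i g := by
  refine pderiv_eq ((hf.continuous_pderiv i).add (hg.continuous_pderiv i)) fun x hx => ?_
  rw [toAmbient_add, partialDeriv_add (hf.differentiableAt hx) (hg.differentiableAt hx) i]
  simp [hf.pderiv_apply i hx, hg.pderiv_apply i hx]

lemma pderiv_comp {f : Orthant n → ℝ} (hf : IsC2c f) {φ : ℝ → ℝ} (hφ : ContDiff ℝ 1 φ)
    (hφ0 : φ 0 = 0) (i : Fin n) :
    pderiv i (φ ∘ f) = fun x => deriv φ (f x) * pderiv i f x := by
  refine pderiv_eq (((hφ.continuous_deriv le_rfl).comp hf.cont).mul (hf.continuous_pderiv i))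
    fun x hx => ?_
  rw [toAmbient_comp hφ0, partialDeriv_comp (hf.differentiableAt hx)
    (hφ.differentiable one_ne_zero _) i]
  simp [hf.pderiv_apply i hx]

lemma pderiv_smul {f : Orthant n → ℝ} (hf : IsC2c f) (c : ℝ) (i : Fin n) :
    pderiv i (c • f) = c • pderiv i f := by
  have := pderiv_comp hf (φ := fun t => c * t) (by fun_prop) (by simp) i
  refine Eq.trans this ?_
  ext x
  simp [deriv_const_mul_id']

lemma eqOn_toAmbient_restrict (G : (Fin n → ℝ) → ℝ) :
    Set.EqOn (toAmbient fun x : Orthant n => G x.1) G (posSet n) := fun x hx => by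
  rw [toAmbient_of_pos _ hx, coe_proj_of_pos hx]

/-- The restriction to the orthant of a compactly supported `C²` function. -/
lemma isC2c_restrict {G : (Fin n → ℝ) → ℝ} (hG : ContDiff ℝ 2 G) (hs : HasCompactSupport G) :
    IsC2c fun x : Orthant n => G x.1 := by
  have hG' : ∀ j : Fin n, ContDiff ℝ 1 fun x => fderiv ℝ G x (Pi.single j 1) := fun j =>
    (hG.fderiv_right (m := 1) (by norm_num [one_add_one_eq_two])).clm_apply contDiff_const
  refine isC2c_of_eqOn (hG.continuous.comp continuous_subtype_val)
    (hs.comp_isClosedEmbedding isClosed_orthant.isClosedEmbedding_subtypeVal)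
    (hG.contDiffOn.congr (eqOn_toAmbient_restrict G))
    (fun i x => fderiv ℝ G x (Pi.single i 1)) (fun i x hx => ?_) (fun i => ?_) (fun i j => ?_)
  · rw [partialDeriv_congr (eqOn_toAmbient_restrict G) i hx,
      partialDeriv_eq_fderiv (hG.differentiable two_ne_zero x)]
  · exact ⟨fun x => fderiv ℝ G x.1 (Pi.single i 1),
      (hG' i).continuous.comp continuous_subtype_val, fun _ _ => rfl⟩
  · refine ⟨fun x => fderiv ℝ (fun x => fderiv ℝ G x (Pi.single j 1)) x.1 (Pi.single i 1),
      ?_, fun x _ => (partialDeriv_eq_fderiv ((hG' j).differentiable one_ne_zero x.1) i).symm⟩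
    exact (((hG' j).continuous_fderiv one_ne_zero).comp continuous_subtype_val).clm_apply
      continuous_const

lemma pderiv_restrict {G : (Fin n → ℝ) → ℝ} (hG : ContDiff ℝ 1 G) (i : Fin n) :
    pderiv i (fun x : Orthant n => G x.1) = fun x => fderiv ℝ G x.1 (Pi.single i 1) := by
  refine pderiv_eq (((hG.continuous_fderiv one_ne_zero).comp continuous_subtype_val).clm_apply
    continuous_const) fun x hx => ?_
  rw [partialDeriv_congr (eqOn_toAmbient_restrict G) i hx,
    partialDeriv_eq_fderiv (hG.differentiable one_ne_zero x.1)]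

/-- Off `tsupport f` the function vanishes near every nearby interior point, so the limit defining
the boundary value is a limit of zeros. -/
lemma hasCompactSupport_pderiv {f : Orthant n → ℝ} (hf : IsC2c f) (i : Fin n) :
    HasCompactSupport (pderiv i f) := by
  refine HasCompactSupport.intro' (K := tsupport f) hf.supp (isClosed_tsupport f) fun x hx => ?_
  have hU : (tsupport f)ᶜ ∈ 𝓝 x := (isClosed_tsupport f).isOpen_compl.mem_nhds hx
  refine extendFrom_eq (dense_openOrthant x) (tendsto_const_nhds.congr' ?_)
  filter_upwards [self_mem_nhdsWithin, mem_nhdsWithin_of_mem_nhds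
    (eventually_mem_nhds_iff.2 hU)] with y hy hyU
  have : toAmbient f =ᶠ[𝓝 y.1] fun _ => 0 := by
    have h1 : ∀ᶠ z in 𝓝 y.1, proj z ∈ (tsupport f)ᶜ := by
      have := continuous_proj.tendsto y.1
      rw [proj_coe] at this
      exact this hyU
    filter_upwards [h1, isOpen_posSet.mem_nhds (show y.1 ∈ posSet n from hy)] with z hz hzp
    rw [toAmbient_of_pos _ hzp]
    exact image_eq_zero_of_notMem_tsupport hz
  rw [partialDeriv, this.lineDeriv_eq]
  simp [lineDeriv]

/-- The fundamental theorem of calculus along coordinate lines, up to the boundary. -/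
lemma IsC2c.sub_eq_integral {f : Orthant n → ℝ} (hf : IsC2c f) (i : Fin n) (x : Fin n → ℝ)
    {a b : ℝ} (ha : 0 < a) (hb : 0 < b) :
    f (proj (Function.update x i b)) - f (proj (Function.update x i a)) =
      ∫ t in a..b, pderiv i f (proj (Function.update x i t)) := by
  have hcp := hf.continuous_pderiv i
  have hcont : Continuous (Function.uncurry fun (x : Fin n → ℝ) (t : ℝ) =>
      pderiv i f (proj (Function.update x i t))) :=
    hcp.comp (continuous_proj.comp (continuous_fst.update i continuous_snd))
  -- Both sides are continuous in `x`, so the identity passes from the open orthant to its closure.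
  -- This covers lines inside boundary faces, where `f` need not be differentiable in the ambient
  -- sense.
  have hcl : IsClosed {x : Fin n → ℝ |
      f (proj (Function.update x i b)) - f (proj (Function.update x i a)) =
      ∫ t in a..b, pderiv i f (proj (Function.update x i t))} := by
    refine isClosed_eq ?_ (intervalIntegral.continuous_parametric_intervalIntegral_of_continuous'
      hcont a b)
    exact (hf.cont.comp (continuous_proj.comp (continuous_id.update i continuous_const))).sub
      (hf.cont.comp (continuous_proj.comp (continuous_id.update i continuous_const)))
  have hpos : ∀ x ∈ posSet n, f (proj (Function.update x i b)) -
      f (proj (Function.update x i a)) =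
      ∫ t in a..b, pderiv i f (proj (Function.update x i t)) := by
    intro x hx
    symm
    refine intervalIntegral.integral_eq_sub_of_hasDerivAt
      (f := fun t => f (proj (Function.update x i t))) (fun t ht => ?_) ?_
    · have ht0 : 0 < t := lt_of_lt_of_le (lt_min ha hb) ht.1
      have hxt : ∀ r : ℝ, 0 < r → Function.update x i r ∈ posSet n := fun r hr j => by
        by_cases hj : j = i
        · subst hj; simpa using hr
        · simpa [hj] using hx j
      have hd : HasLineDerivAt ℝ (toAmbient f)
          (partialDeriv i (toAmbient f) (Function.update x i t)) (Function.update x i t)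
          (Pi.single i 1) :=
        (hf.differentiableAt (hxt t ht0)).lineDifferentiableAt.hasLineDerivAt
      have hd' : HasDerivAt (fun r => toAmbient f (Function.update x i r))
          (partialDeriv i (toAmbient f) (Function.update x i t)) t := by
        unfold HasLineDerivAt at hd
        have h2 := HasDerivAt.comp t (h₂ := fun r => toAmbient f
          (Function.update x i t + r • Pi.single i 1)) (h := fun r => r - t)
          (h₂' := partialDeriv i (toAmbient f) (Function.update x i t)) (h' := 1)
          (by simpa using hd) ((hasDerivAt_id t).sub_const t)
        rw [mul_one] at h2
        refine h2.congr_of_eventuallyEq (Eventually.of_forall fun r => ?_)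
        change toAmbient f _ = toAmbient f _
        congr 1
        ext j
        by_cases hj : j = i
        · subst hj; simp
        · simp [hj]
      have he : (fun r => toAmbient f (Function.update x i r)) =ᶠ[𝓝 t]
          fun r => f (proj (Function.update x i r)) := by
        filter_upwards [lt_mem_nhds ht0] with r hr
        exact toAmbient_of_pos f (hxt r hr)
      have hop : proj (Function.update x i t) ∈ openOrthant n := fun j => by
        rw [coe_proj_of_pos (hxt t ht0)]
        exact hxt t ht0 j
      rw [hf.pderiv_apply i hop, coe_proj_of_pos (hxt t ht0)]
      exact hd'.congr_of_eventuallyEq he.symm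
    · exact (hcont.comp (Continuous.prodMk_right x)).intervalIntegrable _ _
  have hsub : closure (posSet n) ⊆ {x : Fin n → ℝ |
      f (proj (Function.update x i b)) - f (proj (Function.update x i a)) =
      ∫ t in a..b, pderiv i f (proj (Function.update x i t))} :=
    closure_minimal hpos hcl
  have hmem : (proj x).1 ∈ closure (posSet n) := by
    have h1 := (continuous_subtype_val.closure_preimage_subset (X := Orthant n) (posSet n))
    exact h1 (dense_openOrthant (proj x))
  have key := hsub hmem
  -- Both sides of the identity see `x` only through its projection, so an arbitrary ambient `x` may
  -- be replaced by a point of the orthant.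
  have hupd : ∀ r : ℝ, proj (Function.update (proj x).1 i r) = proj (Function.update x i r) :=
    fun r => by
      ext j
      by_cases hj : j = i
      · subst hj; simp [proj]
      · simp [proj, hj]
  simpa [hupd] using key

/-- Differentiates the integral formula. Only the i-th coordinate has to be positive, so the
statement applies on every face containing direction `i`. -/
lemma IsC2c.hasDerivAt_update {f : Orthant n → ℝ} (hf : IsC2c f) (i : Fin n) (x : Fin n → ℝ)
    {t : ℝ} (ht : 0 < t) :
    HasDerivAt (fun r => f (proj (Function.update x i r)))
      (pderiv i f (proj (Function.update x i t))) t := by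
  have hcont : Continuous fun r : ℝ => pderiv i f (proj (Function.update x i r)) :=
    (hf.continuous_pderiv i).comp (continuous_proj.comp (continuous_const.update i continuous_id))
  have h1 : HasDerivAt (fun r => f (proj (Function.update x i t)) +
      ∫ r in t..r, pderiv i f (proj (Function.update x i r)))
      (pderiv i f (proj (Function.update x i t))) t :=
    (intervalIntegral.integral_hasDerivAt_right (hcont.intervalIntegrable _ _)
      (hcont.stronglyMeasurableAtFilter _ _) hcont.continuousAt).const_add _
  refine h1.congr_of_eventuallyEq ?_
  filter_upwards [lt_mem_nhds ht] with r hr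
  rw [← hf.sub_eq_integral i x ht hr]
  ring

end Orthant


/-! ### The face measures and the regrouping of the energy by coordinates. -/

namespace Orthant

variable {n : ℕ}

/-- The factors of the product measure on a face. -/
def coordMeasure (B : Finset (Fin n)) (i : Fin n) : Measure ℝ :=
  if i ∈ B then (volume : Measure ℝ).restrict (Set.Ici 0) else Measure.dirac 0

instance (B : Finset (Fin n)) (i : Fin n) : SigmaFinite (coordMeasure B i) := by
  unfold coordMeasure
  split_ifs <;> infer_instance

instance (B : Finset (Fin n)) (i : Fin n) : IsLocallyFiniteMeasure (coordMeasure B i) := by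
  unfold coordMeasure
  split_ifs <;> infer_instance

lemma faceMeasure_eq (B : Finset (Fin n)) :
    faceMeasure B = (Measure.pi (coordMeasure B)).comap Subtype.val := rfl

/-- The endpoint 0 is Lebesgue-null, while the Dirac measure sees only 0. Hence each face measure is
carried by its own face, and different faces do not interact. -/
lemma ae_coordMeasure (B : Finset (Fin n)) (i : Fin n) :
    ∀ᵐ t ∂coordMeasure B i, 0 ≤ t ∧ (0 < t ↔ i ∈ B) := by
  unfold coordMeasure
  split_ifs with h
  · rw [← Measure.restrict_congr_set (Ioi_ae_eq_Ici (μ := volume) (a := (0 : ℝ)))]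
    filter_upwards [ae_restrict_mem measurableSet_Ioi] with t ht
    exact ⟨le_of_lt ht, by simpa [h] using ht⟩
  · rw [ae_dirac_eq]
    simp [h]

lemma ae_pi_coordMeasure (B : Finset (Fin n)) :
    ∀ᵐ x ∂Measure.pi (coordMeasure B), ∀ i, 0 ≤ x i ∧ (0 < x i ↔ i ∈ B) :=
  ae_all_iff.2 fun i => (Measure.tendsto_eval_ae_ae (i := i)).eventually (ae_coordMeasure B i)

lemma measurableEmbedding_val : MeasurableEmbedding (Subtype.val : Orthant n → Fin n → ℝ) :=
  MeasurableEmbedding.subtype_coe isClosed_orthant.measurableSet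

lemma map_faceMeasure (B : Finset (Fin n)) :
    (faceMeasure B).map Subtype.val = Measure.pi (coordMeasure B) := by
  rw [faceMeasure_eq, measurableEmbedding_val.map_comap]
  refine Measure.restrict_eq_self_of_ae_mem ?_
  filter_upwards [ae_pi_coordMeasure B] with x hx using ⟨⟨x, fun i => (hx i).1⟩, rfl⟩

lemma measurePreserving_val (B : Finset (Fin n)) :
    MeasurePreserving Subtype.val (faceMeasure B) (Measure.pi (coordMeasure B)) :=
  ⟨measurable_subtype_coe, map_faceMeasure B⟩

instance (B : Finset (Fin n)) : IsFiniteMeasureOnCompacts (faceMeasure B) where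
  lt_top_of_isCompact K hK := by
    rw [faceMeasure_eq, measurableEmbedding_val.comap_apply]
    exact (hK.image continuous_subtype_val).measure_lt_top

lemma ae_mem_face (B : Finset (Fin n)) : ∀ᵐ x ∂faceMeasure B, x ∈ face B := by
  have := (measurePreserving_val B).quasiMeasurePreserving.ae (ae_pi_coordMeasure B)
  filter_upwards [this] with x hx i using (hx i).2

lemma measurableSet_pos (i : Fin n) : MeasurableSet {x : Orthant n | 0 < x.1 i} :=
  measurableSet_lt measurable_const ((measurable_pi_apply i).comp measurable_subtype_coe)

lemma measurableSet_face (B : Finset (Fin n)) : MeasurableSet (face B) := by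
  have : face B = ⋂ i, {x : Orthant n | 0 < x.1 i ↔ i ∈ B} := by
    ext x
    simp [face]
  rw [this]
  refine MeasurableSet.iInter fun i => ?_
  by_cases h : i ∈ B
  · simpa [h] using measurableSet_pos i
  · have : {x : Orthant n | 0 < x.1 i ↔ i ∈ B} = {x : Orthant n | 0 < x.1 i}ᶜ := by
      ext x
      simp [h]
    rw [this]
    exact (measurableSet_pos i).compl

lemma disjoint_face {B B' : Finset (Fin n)} (h : B ≠ B') : Disjoint (face B) (face B') := by
  rw [Set.disjoint_left]
  intro x hx hx'
  exact h (Finset.ext fun i => (hx i).symm.trans (hx' i))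

lemma scale_ne_zero {s : ℝ} (hs : 0 < s) (k : ℕ) : ENNReal.ofReal (s ^ k) ≠ 0 := by
  simpa using pow_pos hs k

lemma ae_scaledFaceMeasure {s : ℝ} (hs : 0 < s) (B : Finset (Fin n)) :
    ae (scaledFaceMeasure s B) = ae (faceMeasure B) := by
  rw [scaledFaceMeasure, Measure.ae_ennreal_smul_measure_eq (scale_ne_zero hs _)]

lemma scaledFaceMeasure_le (s : ℝ) (B : Finset (Fin n)) :
    scaledFaceMeasure s B ≤ baseMeasure n s := by
  classical
  rw [baseMeasure, ← Finset.add_sum_erase _ _ (Finset.mem_univ B)]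
  exact Measure.le_add_right le_rfl

lemma ae_base_of_forall {s : ℝ} {p : Orthant n → Prop}
    (h : ∀ B : Finset (Fin n), ∀ᵐ x ∂faceMeasure B, p x) : ∀ᵐ x ∂baseMeasure n s, p x := by
  rw [ae_iff, baseMeasure, Measure.finsetSum_apply]
  refine Finset.sum_eq_zero fun B _ => ?_
  rw [scaledFaceMeasure, Measure.smul_apply, ae_iff.1 (h B), smul_zero]

lemma scaledFaceMeasure_restrict_face {s : ℝ} {B B' : Finset (Fin n)} (h : B ≠ B') :
    (scaledFaceMeasure s B').restrict (face B) = 0 := by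
  rw [Measure.restrict_eq_zero, scaledFaceMeasure, Measure.smul_apply]
  have : faceMeasure B' (face B) = 0 := by
    refine measure_mono_null ?_ (ae_iff.1 (ae_mem_face B'))
    exact fun x hx => Set.disjoint_left.1 (disjoint_face h) hx
  rw [this, smul_zero]

lemma baseMeasure_restrict_face (s : ℝ) (B : Finset (Fin n)) :
    (baseMeasure n s).restrict (face B) = (scaledFaceMeasure s B).restrict (face B) := by
  ext t ht
  rw [Measure.restrict_apply ht, baseMeasure, Measure.finsetSum_apply,
    Finset.sum_eq_single B, Measure.restrict_apply ht]
  · intro B' _ hB'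
    rw [← Measure.restrict_apply ht, scaledFaceMeasure_restrict_face hB'.symm]
    simp
  · simp

lemma refMeasure_restrict_face (s : ℝ) (ϱ : Orthant n → ℝ) (B : Finset (Fin n)) :
    (refMeasure s ϱ).restrict (face B) = (weightedFaceMeasure s ϱ B).restrict (face B) := by
  rw [refMeasure, weightedFaceMeasure, restrict_withDensity (measurableSet_face B),
    restrict_withDensity (measurableSet_face B), baseMeasure_restrict_face]

lemma isFiniteMeasure_refMeasure {s : ℝ} {ϱ : Orthant n → ℝ}
    (hint : Integrable ϱ (baseMeasure n s)) : IsFiniteMeasure (refMeasure s ϱ) :=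
  isFiniteMeasure_withDensity_ofReal hint.2

lemma refMeasure_absolutelyContinuous (s : ℝ) (ϱ : Orthant n → ℝ) :
    refMeasure s ϱ ≪ baseMeasure n s := withDensity_absolutelyContinuous _ _

/-- The part of the reference measure on which the derivative in direction `i` is tangential. -/
def partMeasure (s : ℝ) (ϱ : Orthant n → ℝ) (i : Fin n) : Measure (Orthant n) :=
  (refMeasure s ϱ).restrict {x | 0 < x.1 i}

lemma biUnion_face (i : Fin n) :
    ⋃ B ∈ (Finset.univ.filter fun B : Finset (Fin n) => i ∈ B), face B =
      {x : Orthant n | 0 < x.1 i} := by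
  ext x
  simp only [Finset.mem_filter, Finset.mem_univ, true_and, Set.mem_iUnion, exists_prop]
  constructor
  · rintro ⟨B, hi, hx⟩
    exact (hx i).2 hi
  · intro hx
    exact ⟨Finset.univ.filter fun j => 0 < x.1 j, by simpa using hx, fun j => by simp⟩

lemma IsC2c.memLp {f : Orthant n → ℝ} (hf : IsC2c f) (μ : Measure (Orthant n))
    [IsFiniteMeasure μ] : MemLp f 2 μ :=
  hf.cont.memLp_of_hasCompactSupport hf.supp

lemma IsC2c.memLp_pderiv {f : Orthant n → ℝ} (hf : IsC2c f) (i : Fin n) (μ : Measure (Orthant n))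
    [IsFiniteMeasure μ] : MemLp (pderiv i f) 2 μ :=
  (hf.continuous_pderiv i).memLp_of_hasCompactSupport (hasCompactSupport_pderiv hf i)

lemma IsC2c.integrable_pderiv_mul {f g : Orthant n → ℝ} (hf : IsC2c f) (hg : IsC2c g)
    (i : Fin n) (μ : Measure (Orthant n)) [IsFiniteMeasure μ] :
    Integrable (fun x => pderiv i f x * pderiv i g x) μ :=
  (hf.memLp_pderiv i μ).integrable_mul (hg.memLp_pderiv i μ)

/-- Exchanges the sums over `B` and `i ∈ B`. For fixed `i`, the faces with `i ∈ B` are disjoint with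
union {xᵢ > 0}, and such `B` are automatically nonempty. -/
lemma energy_eq {s : ℝ} {ϱ : Orthant n → ℝ} (hint : Integrable ϱ (baseMeasure n s))
    {f g : Orthant n → ℝ} (hf : IsC2c f) (hg : IsC2c g) :
    energy s ϱ f g = ∑ i, ∫ x, pderiv i f x * pderiv i g x ∂partMeasure s ϱ i := by
  have := isFiniteMeasure_refMeasure hint
  have h1 : ∀ i, ∫ x, pderiv i f x * pderiv i g x ∂partMeasure s ϱ i =
      ∑ B ∈ Finset.univ.filter (fun B : Finset (Fin n) => i ∈ B),
        ∫ x in face B, pderiv i f x * pderiv i g x ∂weightedFaceMeasure s ϱ B := by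
    intro i
    rw [partMeasure, ← biUnion_face, integral_biUnion_finset _ (fun B _ => measurableSet_face B)
      (fun B _ B' _ h => disjoint_face h)
      (fun B _ => (hf.integrable_pderiv_mul hg i _).integrableOn)]
    exact Finset.sum_congr rfl fun B _ => by rw [refMeasure_restrict_face]
  simp_rw [h1, energy, faceEnergy]
  refine Finset.sum_comm' fun B i => ?_
  simp only [Finset.mem_filter, Finset.mem_univ, true_and, and_true]
  exact ⟨fun h => h.2, fun h => ⟨⟨i, h⟩, h⟩⟩

end Orthant


/-! ### Auxiliary integral estimates -/

section Integral

variable {X : Type*} [MeasurableSpace X] {μ : Measure X}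

/-- The Cauchy-Schwarz inequality with a weight `w`. -/
lemma setLIntegral_enorm_le_eLpNorm_withDensity {w : X → ℝ≥0∞} (hw : AEMeasurable w μ)
    (hw0 : ∀ᵐ x ∂μ, w x ≠ 0) (hwt : ∀ᵐ x ∂μ, w x ≠ ∞) {g : X → ℝ}
    (hg : AEStronglyMeasurable g μ) (K : Set X) :
    ∫⁻ x in K, ‖g x‖ₑ ∂μ ≤
      eLpNorm g 2 (μ.withDensity w) * (∫⁻ x in K, (w x)⁻¹ ∂μ) ^ (1 / 2 : ℝ) := by
  have hcs := ENNReal.lintegral_mul_le_Lp_mul_Lq (μ.restrict K)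
    Real.HolderConjugate.two_two (f := fun x => ‖g x‖ₑ * w x ^ (1 / 2 : ℝ))
    (g := fun x => (w x)⁻¹ ^ (1 / 2 : ℝ))
    ((hg.enorm.mul (hw.pow_const _)).restrict) ((hw.inv.pow_const _).restrict)
  have e1 : ∫⁻ x in K, ‖g x‖ₑ ∂μ = ∫⁻ x in K, ((fun x => ‖g x‖ₑ * w x ^ (1 / 2 : ℝ)) *
      fun x => (w x)⁻¹ ^ (1 / 2 : ℝ)) x ∂μ := by
    refine lintegral_congr_ae ?_
    -- The factorization g = (g w^{1/2}) · w^{-1/2} is legitimate where `w` is neither 0 nor ∞.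
    filter_upwards [ae_restrict_of_ae hw0, ae_restrict_of_ae hwt] with x h0 ht
    rw [Pi.mul_apply, mul_assoc, ← ENNReal.mul_rpow_of_nonneg _ _ (by norm_num),
      ENNReal.mul_inv_cancel h0 ht, ENNReal.one_rpow, mul_one]
  have e2 : ∀ a : ℝ≥0∞, (a ^ (1 / 2 : ℝ)) ^ (2 : ℝ) = a := fun a => by
    rw [← ENNReal.rpow_mul]
    norm_num
  rw [e1]
  refine hcs.trans ?_
  simp_rw [e2]
  gcongr
  rw [eLpNorm_eq_lintegral_rpow_enorm_toReal two_ne_zero ENNReal.ofNat_ne_top,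
    ENNReal.toReal_ofNat, lintegral_withDensity_eq_lintegral_mul₀ hw (hg.enorm.pow_const _)]
  refine ENNReal.rpow_le_rpow ((setLIntegral_le_lintegral _ _).trans (lintegral_mono fun x => ?_))
    (by norm_num)
  rw [ENNReal.mul_rpow_of_nonneg _ _ (by norm_num), e2, Pi.mul_apply, mul_comm]

lemma tendsto_integral_mul_of_tendsto_setLIntegral {ψ : X → ℝ} {M : ℝ} (hM : ∀ x, |ψ x| ≤ M)
    {K : Set X} (hK : MeasurableSet K) (hψ : ∀ᵐ x ∂μ, x ∉ K → ψ x = 0) {g : ℕ → X → ℝ}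
    (hg : Tendsto (fun k => ∫⁻ x in K, ‖g k x‖ₑ ∂μ) atTop (𝓝 0)) :
    Tendsto (fun k => ∫ x, ψ x * g k x ∂μ) atTop (𝓝 0) := by
  rw [tendsto_zero_iff_enorm_tendsto_zero]
  have h1 : Tendsto (fun k => ENNReal.ofReal M * ∫⁻ x in K, ‖g k x‖ₑ ∂μ) atTop (𝓝 0) := by
    simpa using ENNReal.Tendsto.const_mul hg (Or.inr ENNReal.ofReal_ne_top)
  refine tendsto_of_tendsto_of_tendsto_of_le_of_le tendsto_const_nhds h1 (fun _ => zero_le)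
    fun k => (enorm_integral_le_lintegral_enorm _).trans ?_
  rw [← lintegral_const_mul' _ _ ENNReal.ofReal_ne_top, ← lintegral_indicator hK]
  refine lintegral_mono_ae ?_
  filter_upwards [hψ] with x hx
  by_cases hxK : x ∈ K
  · rw [Set.indicator_of_mem hxK, enorm_mul]
    gcongr
    rw [← ofReal_norm, Real.norm_eq_abs]
    exact ENNReal.ofReal_le_ofReal (hM x)
  · simp [hx hxK]

end Integral

/-! ### Integration by parts on faces and vanishing of limit gradients. -/

namespace Orthant

variable {n : ℕ}

lemma hasCompactSupport_comp_update {g : (Fin n → ℝ) → ℝ} (hg : HasCompactSupport g)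
    (x : Fin n → ℝ) (i : Fin n) : HasCompactSupport fun t : ℝ => g (Function.update x i t) := by
  obtain ⟨R, hR⟩ := hg.isCompact.isBounded.subset_closedBall 0
  refine HasCompactSupport.intro (isCompact_closedBall (0 : ℝ) R) fun t ht => ?_
  refine image_eq_zero_of_notMem_tsupport fun hmem => ht ?_
  have h1 := hR hmem
  rw [mem_closedBall_zero_iff] at h1 ⊢
  refine le_trans ?_ h1
  simpa using norm_le_pi_norm (Function.update x i t) i

/-- The integrand is the derivative of `φ f` along the i-th line, and `i ∈ B` makes the measure
Lebesgue on the half line. There is no boundary term: the support of `φ` avoids yᵢ = 0 and is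
compact. -/
lemma integral_coordMeasure_eq_zero {f : Orthant n → ℝ} (hf : IsC2c f) {φ : (Fin n → ℝ) → ℝ}
    (hφ : ContDiff ℝ 1 φ) (hs : HasCompactSupport φ) (i : Fin n)
    (hsub : tsupport φ ⊆ {y | 0 < y i}) {B : Finset (Fin n)} (hi : i ∈ B) (x : Fin n → ℝ) :
    ∫ t, (φ (Function.update x i t) * pderiv i f (proj (Function.update x i t)) +
      fderiv ℝ φ (Function.update x i t) (Pi.single i 1) * f (proj (Function.update x i t)))
      ∂coordMeasure B i = 0 := by
  have hu : Continuous fun t : ℝ => Function.update x i t := continuous_const.update i continuous_id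
  have hφd : Continuous fun y => fderiv ℝ φ y (Pi.single i 1) :=
    (hφ.continuous_fderiv one_ne_zero).clm_apply continuous_const
  have hsd : HasCompactSupport fun y => fderiv ℝ φ y (Pi.single i 1) := hs.fderiv_apply ℝ _
  rw [coordMeasure, if_pos hi, ← Measure.restrict_congr_set (Ioi_ae_eq_Ici (μ := volume))]
  have hlim : Tendsto (fun t => φ (Function.update x i t) * f (proj (Function.update x i t)))
      atTop (𝓝 0) := by
    have h1 : HasCompactSupport fun t =>
        φ (Function.update x i t) * f (proj (Function.update x i t)) :=
      (hasCompactSupport_comp_update hs x i).mul_right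
    exact h1.is_zero_at_infty.mono_left atTop_le_cocompact
  rw [integral_Ioi_of_hasDerivAt_of_tendsto
    (f := fun t => φ (Function.update x i t) * f (proj (Function.update x i t))) ?_ ?_ ?_ hlim]
  · have : φ (Function.update x i 0) = 0 :=
      image_eq_zero_of_notMem_tsupport fun h => by simpa using hsub h
    simp [this]
  · exact ((hφ.continuous.comp hu).mul
      (hf.cont.comp (continuous_proj.comp hu))).continuousWithinAt
  · intro t ht
    have h1 : HasDerivAt (fun t => φ (Function.update x i t))
        (fderiv ℝ φ (Function.update x i t) (Pi.single i 1)) t :=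
      (hφ.differentiable one_ne_zero _).hasFDerivAt.comp_hasDerivAt t (hasDerivAt_update x i t)
    have h2 := h1.mul (hf.hasDerivAt_update i x ht)
    rwa [add_comm] at h2
  · refine Integrable.integrableOn (Continuous.integrable_of_hasCompactSupport ?_ ?_)
    · exact ((hφ.continuous.comp hu).mul
        ((hf.continuous_pderiv i).comp (continuous_proj.comp hu))).add
        ((hφd.comp hu).mul (hf.cont.comp (continuous_proj.comp hu)))
    · exact (hasCompactSupport_comp_update hs x i).mul_right.add
        (hasCompactSupport_comp_update hsd x i).mul_right

/-- Integration by parts on a face. -/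
lemma integral_mul_pderiv {f : Orthant n → ℝ} (hf : IsC2c f) {φ : (Fin n → ℝ) → ℝ}
    (hφ : ContDiff ℝ 1 φ) (hs : HasCompactSupport φ) (i : Fin n)
    (hsub : tsupport φ ⊆ {y | 0 < y i}) {B : Finset (Fin n)} (hi : i ∈ B) :
    ∫ x, φ x.1 * pderiv i f x ∂faceMeasure B =
      -∫ x, fderiv ℝ φ x.1 (Pi.single i 1) * f x ∂faceMeasure B := by
  have hφd : Continuous fun y => fderiv ℝ φ y (Pi.single i 1) :=
    (hφ.continuous_fderiv one_ne_zero).clm_apply continuous_const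
  have hsd : HasCompactSupport fun y => fderiv ℝ φ y (Pi.single i 1) := hs.fderiv_apply ℝ _
  have hem := isClosed_orthant (n := n) |>.isClosedEmbedding_subtypeVal
  have hi1 : Integrable (fun x : Orthant n => φ x.1 * pderiv i f x) (faceMeasure B) :=
    ((hφ.continuous.comp continuous_subtype_val).mul
      (hf.continuous_pderiv i)).integrable_of_hasCompactSupport
      (hs.comp_isClosedEmbedding hem).mul_right
  have hi2 : Integrable (fun x : Orthant n => fderiv ℝ φ x.1 (Pi.single i 1) * f x)
      (faceMeasure B) :=
    ((hφd.comp continuous_subtype_val).mul hf.cont).integrable_of_hasCompactSupport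
      (hsd.comp_isClosedEmbedding hem).mul_right
  rw [eq_neg_iff_add_eq_zero, ← integral_add hi1 hi2]
  set Ψ : (Fin n → ℝ) → ℝ := fun y =>
    φ y * pderiv i f (proj y) + fderiv ℝ φ y (Pi.single i 1) * f (proj y) with hΨ
  have hΨc : Continuous Ψ := (hφ.continuous.mul ((hf.continuous_pderiv i).comp
    continuous_proj)).add (hφd.mul (hf.cont.comp continuous_proj))
  have hΨs : HasCompactSupport Ψ := hs.mul_right.add hsd.mul_right
  have e1 : ∫ x : Orthant n, (φ x.1 * pderiv i f x + fderiv ℝ φ x.1 (Pi.single i 1) * f x)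
      ∂faceMeasure B = ∫ y, Ψ y ∂Measure.pi (coordMeasure B) := by
    rw [← map_faceMeasure, measurableEmbedding_val.integral_map]
    simp [hΨ]
  rw [e1]
  cases n with
  | zero => exact i.elim0
  | succ m =>
    have hmp := (measurePreserving_piFinSuccAbove (coordMeasure B) i).symm
    rw [← hmp.integral_comp' Ψ, integral_prod_symm]
    · refine integral_eq_zero_of_ae (Eventually.of_forall fun z => ?_)
      have h0 := integral_coordMeasure_eq_zero hf hφ hs i hsub hi (i.insertNth 0 z)
      simp_rw [Fin.update_insertNth] at h0
      simpa [MeasurableEquiv.piFinSuccAbove_symm_apply, Fin.insertNthEquiv] using h0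
    · have : Integrable Ψ (Measure.pi (coordMeasure B)) :=
        hΨc.integrable_of_hasCompactSupport hΨs
      exact (hmp.integrable_comp_emb (MeasurableEquiv.measurableEmbedding _)).2 this

/-- Lets L² bounds on all of {xᵢ > 0} be used on a single face. -/
lemma weightedFaceMeasure_le_partMeasure (s : ℝ) (ϱ : Orthant n → ℝ) {B : Finset (Fin n)}
    {i : Fin n} (hi : i ∈ B) : weightedFaceMeasure s ϱ B ≤ partMeasure s ϱ i := by
  have hae : ∀ᵐ x ∂weightedFaceMeasure s ϱ B, x ∈ face B :=
    (withDensity_absolutelyContinuous _ _).trans (Measure.smul_absolutelyContinuous)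
      (ae_mem_face B)
  rw [← Measure.restrict_eq_self_of_ae_mem hae, ← refMeasure_restrict_face, partMeasure]
  exact Measure.restrict_mono (fun x hx => (hx i).2 hi) le_rfl

lemma continuous_euclidean_dist (x : Orthant n) :
    Continuous fun y : Orthant n => Real.sqrt (∑ i, (x.1 i - y.1 i) ^ 2) :=
  (show Continuous fun y : Fin n → ℝ => Real.sqrt (∑ i, (x.1 i - y i) ^ 2) by fun_prop).comp
    continuous_subtype_val

lemma isClosed_faceBall (B : Finset (Fin n)) (x : Orthant n) (ε : ℝ) :
    IsClosed (faceBall B x ε) :=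
  isClosed_closure.and (isClosed_le (continuous_euclidean_dist x) continuous_const)

section Closability

variable {s : ℝ} {ϱ : Orthant n → ℝ} (hs : 0 < s)
  (hpos : ∀ᵐ x ∂baseMeasure n s, 0 < ϱ x) (hint : Integrable ϱ (baseMeasure n s))

include hs hpos hint

/-- Local integrability of 1/ϱ makes weighted L² convergence imply L¹ convergence on the ball. Then
∫ φ h = lim ∫ φ ∂ᵢfₖ = -lim ∫ ∂ᵢφ fₖ = 0 for every admissible test function `φ`. -/
lemma ae_face_eq_zero_near {B : Finset (Fin n)} {i : Fin n} (hi : i ∈ B)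
    {f : ℕ → Orthant n → ℝ} (hf : ∀ k, IsC2c (f k)) {h : Orthant n → ℝ}
    (hh : MemLp h 2 (partMeasure s ϱ i))
    (hf0 : Tendsto (fun k => eLpNorm (f k) 2 (refMeasure s ϱ)) atTop (𝓝 0))
    (hfh : Tendsto (fun k => eLpNorm (pderiv i (f k) - h) 2 (partMeasure s ϱ i)) atTop (𝓝 0))
    (x₀ : Orthant n) {ε : ℝ}
    (hfin : ∫⁻ y in faceBall B x₀ ε, (ENNReal.ofReal (ϱ y))⁻¹ ∂scaledFaceMeasure s B < ∞) :
    ∀ᵐ x ∂scaledFaceMeasure s B, Real.sqrt (∑ j, (x₀.1 j - x.1 j) ^ 2) < ε → h x = 0 := by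
  set L := scaledFaceMeasure s B with hL
  set K := faceBall B x₀ ε with hK
  have hKm : MeasurableSet K := (isClosed_faceBall B x₀ ε).measurableSet
  have hposL : ∀ᵐ x ∂L, 0 < ϱ x := ae_mono (scaledFaceMeasure_le s B) hpos
  have hface : ∀ᵐ x ∂L, x ∈ face B := by
    rw [hL, ae_scaledFaceMeasure hs]
    exact ae_mem_face B
  have hw : AEMeasurable (fun x => ENNReal.ofReal (ϱ x)) L :=
    (hint.aemeasurable.mono_measure (scaledFaceMeasure_le s B)).ennreal_ofReal
  have hw0 : ∀ᵐ x ∂L, ENNReal.ofReal (ϱ x) ≠ 0 := by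
    filter_upwards [hposL] with x hx
    simpa using hx
  have hWle := weightedFaceMeasure_le_partMeasure s ϱ hi
  -- Positivity of ϱ lets measurability of `h` pass back from the weighted to the unweighted face
  -- measure.
  have hac : L ≪ weightedFaceMeasure s ϱ B := withDensity_absolutelyContinuous' hw hw0
  have hac' : L ≪ partMeasure s ϱ i := hac.trans hWle.absolutelyContinuous
  have hhm : AEStronglyMeasurable h L := hh.1.mono_ac hac'
  have hCS : ∀ g : Orthant n → ℝ, AEStronglyMeasurable g L → ∫⁻ x in K, ‖g x‖ₑ ∂L ≤
      eLpNorm g 2 (partMeasure s ϱ i) *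
        (∫⁻ x in K, (ENNReal.ofReal (ϱ x))⁻¹ ∂L) ^ (1 / 2 : ℝ) := fun g hg =>
    (setLIntegral_enorm_le_eLpNorm_withDensity hw hw0 (ae_of_all _ fun _ => ENNReal.ofReal_ne_top)
      hg K).trans (mul_le_mul_left (eLpNorm_mono_measure g hWle) _)
  have hCfin : (∫⁻ x in K, (ENNReal.ofReal (ϱ x))⁻¹ ∂L) ^ (1 / 2 : ℝ) ≠ ∞ :=
    ENNReal.rpow_ne_top_of_nonneg (by norm_num) hfin.ne
  have hlim : ∀ g : ℕ → Orthant n → ℝ, (∀ k, AEStronglyMeasurable (g k) L) →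
      Tendsto (fun k => eLpNorm (g k) 2 (partMeasure s ϱ i)) atTop (𝓝 0) →
      Tendsto (fun k => ∫⁻ x in K, ‖g k x‖ₑ ∂L) atTop (𝓝 0) := fun g hg hg0 => by
    have h1 := ENNReal.Tendsto.mul_const hg0 (Or.inr hCfin)
    rw [zero_mul] at h1
    exact tendsto_of_tendsto_of_tendsto_of_le_of_le tendsto_const_nhds h1 (fun _ => zero_le)
      fun k => hCS _ (hg k)
  have hlim1 : Tendsto (fun k => ∫⁻ x in K, ‖f k x‖ₑ ∂L) atTop (𝓝 0) := by
    refine hlim f (fun k => (hf k).cont.aestronglyMeasurable) ?_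
    exact tendsto_of_tendsto_of_tendsto_of_le_of_le tendsto_const_nhds hf0 (fun _ => zero_le)
      fun k => eLpNorm_mono_measure _ Measure.restrict_le_self
  have hlim2 : Tendsto (fun k => ∫⁻ x in K, ‖(pderiv i (f k) - h) x‖ₑ ∂L) atTop (𝓝 0) :=
    hlim _ (fun k => ((hf k).continuous_pderiv i).aestronglyMeasurable.sub hhm) hfh
  -- Test functions supported in `V` stay away from yᵢ = 0, as integration by parts requires.
  -- Coordinates other than `i` are unconstrained, and almost no point of the face is lost by
  -- demanding yᵢ > 0.
  set V : Set (Fin n → ℝ) := {y | Real.sqrt (∑ j, (x₀.1 j - y j) ^ 2) < ε} ∩ {y | 0 < y i}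
    with hV
  have hVo : IsOpen V := by
    refine IsOpen.inter (isOpen_lt ?_ continuous_const)
      (isOpen_lt continuous_const (continuous_apply i))
    fun_prop
  have hVK : ∀ᵐ x ∂L, x.1 ∈ V → x ∈ K := by
    filter_upwards [hface] with x hx hxV
    exact ⟨subset_closure hx, hxV.1.le⟩
  have hiK : IntegrableOn h K L :=
    ⟨hhm.restrict, (hCS h hhm).trans_lt (ENNReal.mul_lt_top hh.2 hCfin.lt_top)⟩
  have hiV : IntegrableOn h (Subtype.val ⁻¹' V) L := hiK.mono_set_ae hVK
  have hem := isClosed_orthant (n := n) |>.isClosedEmbedding_subtypeVal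
  -- The fundamental lemma of the calculus of variations is applied to the pushed-forward face
  -- measure on ℝⁿ itself, which avoids parametrizing the face by ℝ^{#B}.
  have main : ∀ᵐ y ∂L.map Subtype.val, y ∈ V → h (proj y) = 0 := by
    refine hVo.ae_eq_zero_of_integral_contDiff_smul_eq_zero ?_ fun φ hφ hφs hφV => ?_
    · refine IntegrableOn.locallyIntegrableOn ?_
      rw [measurableEmbedding_val.integrableOn_map_iff]
      refine hiV.congr_fun_ae (Eventually.of_forall fun x => ?_)
      simp
    · rw [measurableEmbedding_val.integral_map]
      simp only [proj_coe, smul_eq_mul]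
      have hφ1 : ContDiff ℝ 1 φ := hφ.of_le (by exact_mod_cast le_top)
      have hφd : Continuous fun y => fderiv ℝ φ y (Pi.single i 1) :=
        (hφ1.continuous_fderiv one_ne_zero).clm_apply continuous_const
      have hsd : HasCompactSupport fun y => fderiv ℝ φ y (Pi.single i 1) :=
        hφs.fderiv_apply ℝ _
      obtain ⟨M, hM⟩ := hφs.exists_bound_of_continuous hφ.continuous
      obtain ⟨M', hM'⟩ := hsd.exists_bound_of_continuous hφd
      have hz : ∀ᵐ x ∂L, x ∉ K → φ x.1 = 0 := by
        filter_upwards [hVK] with x hx hxK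
        exact image_eq_zero_of_notMem_tsupport fun hm => hxK (hx (hφV hm))
      have hz' : ∀ᵐ x ∂L, x ∉ K → fderiv ℝ φ x.1 (Pi.single i 1) = 0 := by
        filter_upwards [hVK] with x hx hxK
        have : fderiv ℝ φ x.1 = 0 := by
          by_contra hne
          exact hxK (hx (hφV (support_fderiv_subset ℝ hne)))
        simp [this]
      have hibp : ∀ k, ∫ x : Orthant n, φ x.1 * pderiv i (f k) x ∂L =
          -∫ x : Orthant n, fderiv ℝ φ x.1 (Pi.single i 1) * f k x ∂L := fun k => by
        rw [hL, scaledFaceMeasure, integral_smul_measure, integral_smul_measure,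
          integral_mul_pderiv (hf k) hφ1 hφs i (fun y hy => (hφV hy).2) hi, smul_neg]
      have t1 := tendsto_integral_mul_of_tendsto_setLIntegral (μ := L)
        (ψ := fun x => φ x.1) (fun x => hM x.1) hKm hz hlim2
      have t2 := (tendsto_integral_mul_of_tendsto_setLIntegral (μ := L)
        (ψ := fun x => fderiv ℝ φ x.1 (Pi.single i 1)) (fun x => hM' x.1) hKm hz' hlim1).neg
      have hintφ : Integrable (fun x : Orthant n => φ x.1 * h x) L := by
        have h1 : IntegrableOn (fun x : Orthant n => φ x.1 * h x) K L :=
          hiK.bdd_mul (hφ.continuous.comp continuous_subtype_val).aestronglyMeasurable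
            (ae_of_all _ fun x => hM x.1)
        rw [← integrable_indicator_iff hKm] at h1
        refine h1.congr ?_
        filter_upwards [hz] with x hx
        by_cases hxK : x ∈ K
        · simp [hxK]
        · simp [hxK, hx hxK]
      have hLfin : IsFiniteMeasureOnCompacts L :=
        ⟨fun K hK => ENNReal.mul_lt_top ENNReal.ofReal_lt_top hK.measure_lt_top⟩
      have hintk : ∀ k, Integrable (fun x : Orthant n => φ x.1 * pderiv i (f k) x) L := fun k =>
        ((hφ.continuous.comp continuous_subtype_val).mul
          ((hf k).continuous_pderiv i)).integrable_of_hasCompactSupport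
          (hφs.comp_isClosedEmbedding hem).mul_right
      have t3 : Tendsto (fun _ : ℕ => ∫ x : Orthant n, φ x.1 * h x ∂L) atTop (𝓝 0) := by
        have := t2.sub t1
        simp only [neg_zero, sub_zero] at this
        refine this.congr fun k => ?_
        rw [← hibp k, ← integral_sub (hintk k)]
        · congr 1
          ext x
          simp only [Pi.sub_apply]
          ring
        · have := (hintk k).sub hintφ
          refine this.congr (ae_of_all _ fun x => ?_)
          simp only [Pi.sub_apply]
          ring
      exact tendsto_nhds_unique tendsto_const_nhds t3
  rw [measurableEmbedding_val.ae_map_iff] at main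
  filter_upwards [main, hface] with x hx hxf hlt
  simpa using hx ⟨hlt, (hxf i).2 hi⟩

/-- Since ϱ > 0 a.e., the Hamza condition says that almost every point of each face is regular, so
the local vanishing result applies near almost every point. -/
lemma ae_partMeasure_eq_zero (hHamza : HamzaCondition s ϱ) {i : Fin n}
    {f : ℕ → Orthant n → ℝ} (hf : ∀ k, IsC2c (f k)) {h : Orthant n → ℝ}
    (hh : MemLp h 2 (partMeasure s ϱ i))
    (hf0 : Tendsto (fun k => eLpNorm (f k) 2 (refMeasure s ϱ)) atTop (𝓝 0))
    (hfh : Tendsto (fun k => eLpNorm (pderiv i (f k) - h) 2 (partMeasure s ϱ i)) atTop (𝓝 0)) :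
    h =ᵐ[partMeasure s ϱ i] 0 := by
  have key : ∀ B : Finset (Fin n), i ∈ B → ∀ᵐ x ∂faceMeasure B, h x = 0 := by
    intro B hi
    have hreg : ∀ᵐ x ∂scaledFaceMeasure s B, x ∈ regularSet s ϱ B := by
      have hface : ∀ᵐ x ∂scaledFaceMeasure s B, x ∈ face B := by
        rw [ae_scaledFaceMeasure hs]
        exact ae_mem_face B
      filter_upwards [hHamza B ⟨i, hi⟩, hface, ae_mono (scaledFaceMeasure_le s B) hpos]
        with x h1 h2 h3
      by_contra hx
      exact h3.ne' (h1 ⟨subset_closure h2, hx⟩)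
    rw [← ae_scaledFaceMeasure hs]
    have hnull : scaledFaceMeasure s B {x | x ∈ regularSet s ϱ B ∧ h x ≠ 0} = 0 := by
      -- Second countability of the orthant turns the uncountable family of good balls into a
      -- countable cover.
      refine measure_null_of_locally_null _ fun x₀ hx₀ => ?_
      obtain ⟨-, ε, hε, hfin⟩ := hx₀.1
      have hnear := ae_face_eq_zero_near hs hpos hint hi hf hh hf0 hfh x₀ hfin
      refine ⟨{x | Real.sqrt (∑ j, (x₀.1 j - x.1 j) ^ 2) < ε} ∩
        {x | x ∈ regularSet s ϱ B ∧ h x ≠ 0}, ?_, ?_⟩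
      · refine inter_mem (mem_nhdsWithin_of_mem_nhds (IsOpen.mem_nhds ?_ ?_)) self_mem_nhdsWithin
        · exact isOpen_lt (continuous_euclidean_dist x₀) continuous_const
        · simpa using hε
      · refine measure_mono_null ?_ (ae_iff.1 hnear)
        rintro x ⟨hx1, -, hx2⟩ hx3
        exact hx2 (hx3 hx1)
    filter_upwards [hreg, compl_mem_ae_iff.2 hnull] with x hx1 hx2
    by_contra hx3
    exact hx2 ⟨hx1, hx3⟩
  have hbase : ∀ᵐ x ∂baseMeasure n s, 0 < x.1 i → h x = 0 := by
    refine ae_base_of_forall fun B => ?_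
    by_cases hi : i ∈ B
    · filter_upwards [key B hi] with x hx _ using hx
    · filter_upwards [ae_mem_face B] with x hx hxi
      exact absurd ((hx i).1 hxi) hi
  exact (ae_restrict_iff' (measurableSet_pos i)).2 (refMeasure_absolutelyContinuous s ϱ hbase)

end Closability

end Orthant


/-! ### Convergence in `L²` -/

section Lp

variable {X : Type*} [MeasurableSpace X] {μ : Measure X}

lemma tendsto_eLpNorm_zero_of_dominated {F : ℕ → X → ℝ} {G : X → ℝ}
    (hF : ∀ k, AEStronglyMeasurable (F k) μ) (hG : MemLp G 2 μ)
    (hb : ∀ k, ∀ᵐ x ∂μ, ‖F k x‖ ≤ ‖G x‖) (hlim : ∀ᵐ x ∂μ, Tendsto (fun k => F k x) atTop (𝓝 0)) :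
    Tendsto (fun k => eLpNorm (F k) 2 μ) atTop (𝓝 0) := by
  simp_rw [eLpNorm_eq_lintegral_rpow_enorm_toReal two_ne_zero ENNReal.ofNat_ne_top,
    ENNReal.toReal_ofNat]
  have h1 : Tendsto (fun k => ∫⁻ x, ‖F k x‖ₑ ^ (2 : ℝ) ∂μ) atTop (𝓝 (∫⁻ _, 0 ∂μ)) := by
    refine tendsto_lintegral_of_dominated_convergence' (fun x => ‖G x‖ₑ ^ (2 : ℝ))
      (fun k => (hF k).enorm.pow_const _) (fun k => ?_) ?_ ?_
    · filter_upwards [hb k] with x hx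
      exact ENNReal.rpow_le_rpow (enorm_le_iff_norm_le.2 hx) (by norm_num)
    · have := lintegral_rpow_enorm_lt_top_of_eLpNorm_lt_top two_ne_zero ENNReal.ofNat_ne_top hG.2
      simpa using this.ne
    · filter_upwards [hlim] with x hx
      have h2 := (ENNReal.continuous_rpow_const (y := 2)).tendsto 0 |>.comp
        (tendsto_zero_iff_enorm_tendsto_zero.1 hx)
      simpa [Function.comp_def] using h2
  have h3 := (ENNReal.continuous_rpow_const (y := 1 / 2)).tendsto _ |>.comp h1
  simpa [Function.comp_def] using h3

/-- Multiplication by boundedly convergent factors preserves `L²`-convergence. -/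
lemma tendsto_eLpNorm_mul_sub {a : ℕ → X → ℝ} {b : X → ℝ} {g : ℕ → X → ℝ} {h : X → ℝ}
    (ha : ∀ k, AEStronglyMeasurable (a k) μ) (ha1 : ∀ k x, |a k x| ≤ 1)
    (hab : ∀ᵐ x ∂μ, Tendsto (fun k => a k x) atTop (𝓝 (b x)))
    (hg : ∀ k, AEStronglyMeasurable (g k) μ) (hh : MemLp h 2 μ)
    (hgh : Tendsto (fun k => eLpNorm (g k - h) 2 μ) atTop (𝓝 0)) :
    Tendsto (fun k => eLpNorm ((fun x => a k x * g k x) - fun x => b x * h x) 2 μ) atTop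
      (𝓝 0) := by
  have hb : AEStronglyMeasurable b μ := aestronglyMeasurable_of_tendsto_ae atTop ha hab
  have hb1 : ∀ᵐ x ∂μ, |b x| ≤ 1 := by
    filter_upwards [hab] with x hx
    exact le_of_tendsto hx.abs (Eventually.of_forall fun k => ha1 k x)
  have h2 : Tendsto (fun k => eLpNorm (fun x => (a k x - b x) * h x) 2 μ) atTop (𝓝 0) := by
    refine tendsto_eLpNorm_zero_of_dominated (fun k => ((ha k).sub hb).mul hh.1)
      (hh.const_mul 2) (fun k => ?_) ?_
    · filter_upwards [hb1] with x hx
      rw [norm_mul, norm_mul]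
      gcongr
      rw [Real.norm_eq_abs, Real.norm_eq_abs, abs_two]
      exact (abs_sub _ _).trans (by linarith [ha1 k x])
    · filter_upwards [hab] with x hx
      have := (hx.sub_const (b x)).mul_const (h x)
      simpa using this
  have hsum := hgh.add h2
  rw [add_zero] at hsum
  refine tendsto_of_tendsto_of_tendsto_of_le_of_le tendsto_const_nhds hsum (fun _ => zero_le)
    fun k => ?_
  -- The first summand is controlled by `g k - h` because |aₖ| ≤ 1; the second is `h2`, dominated by
  -- 2|h|.
  have e : ((fun x => a k x * g k x) - fun x => b x * h x) =
      (fun x => a k x * (g k - h) x) + fun x => (a k x - b x) * h x := by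
    ext x
    simp only [Pi.sub_apply, Pi.add_apply]
    ring
  rw [e]
  refine (eLpNorm_add_le ((ha k).mul ((hg k).sub hh.1)) (((ha k).sub hb).mul hh.1)
    one_le_two).trans ?_
  refine add_le_add (eLpNorm_mono fun x => ?_) le_rfl
  rw [Pi.mul_apply, norm_mul]
  exact mul_le_of_le_one_left (norm_nonneg _) (ha1 k x)

end Lp

/-! ### Primitives of bounded functions -/

/-- The primitive of `ψ` vanishing at `0`. -/
def primitive (ψ : ℝ → ℝ) (t : ℝ) : ℝ := ∫ r in (0 : ℝ)..t, ψ r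

lemma primitive_zero (ψ : ℝ → ℝ) : primitive ψ 0 = 0 := by simp [primitive]

lemma hasDerivAt_primitive {ψ : ℝ → ℝ} (hψ : Continuous ψ) (t : ℝ) :
    HasDerivAt (primitive ψ) (ψ t) t :=
  intervalIntegral.integral_hasDerivAt_right (hψ.intervalIntegrable _ _)
    (hψ.stronglyMeasurableAtFilter _ _) hψ.continuousAt

lemma deriv_primitive {ψ : ℝ → ℝ} (hψ : Continuous ψ) : deriv (primitive ψ) = ψ :=
  funext fun t => (hasDerivAt_primitive hψ t).deriv

lemma contDiff_primitive {ψ : ℝ → ℝ} (hψ : ContDiff ℝ 1 ψ) : ContDiff ℝ 2 (primitive ψ) := by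
  rw [← one_add_one_eq_two]
  refine contDiff_succ_iff_deriv.2
    ⟨fun t => (hasDerivAt_primitive hψ.continuous t).differentiableAt, by simp, ?_⟩
  rwa [deriv_primitive hψ.continuous]

lemma abs_primitive_sub_le {ψ : ℝ → ℝ} (hψ : Continuous ψ) (h1 : ∀ t, |ψ t| ≤ 1) (a b : ℝ) :
    |primitive ψ a - primitive ψ b| ≤ |a - b| := by
  rw [primitive, primitive, intervalIntegral.integral_interval_sub_left
    (hψ.intervalIntegrable _ _) (hψ.intervalIntegrable _ _)]
  simpa using intervalIntegral.norm_integral_le_of_norm_le_const (a := b) (b := a) (C := 1)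
    (f := ψ) fun x _ => h1 x

lemma abs_primitive_le {ψ : ℝ → ℝ} (hψ : Continuous ψ) (h1 : ∀ t, |ψ t| ≤ 1) (a : ℝ) :
    |primitive ψ a| ≤ |a| := by
  simpa [primitive_zero] using abs_primitive_sub_le hψ h1 a 0

lemma tendsto_primitive {ψ : ℕ → ℝ → ℝ} {χ : ℝ → ℝ} (hψ : ∀ k, Continuous (ψ k))
    (h1 : ∀ k t, |ψ k t| ≤ 1) (hχ : ∀ t, Tendsto (fun k => ψ k t) atTop (𝓝 (χ t))) (t : ℝ) :
    Tendsto (fun k => primitive (ψ k) t) atTop (𝓝 (primitive χ t)) := by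
  refine intervalIntegral.tendsto_integral_filter_of_dominated_convergence (fun _ => 1)
    (Eventually.of_forall fun k => (hψ k).aestronglyMeasurable)
    (Eventually.of_forall fun k => ae_of_all _ fun x _ => h1 k x) (by simp)
    (ae_of_all _ fun x _ => hχ x)

/-! ### The closed gradient, its chain rule and its vanishing on level sets. -/

namespace Orthant

variable {n : ℕ} {s : ℝ} {ϱ : Orthant n → ℝ}

/-- `(u, h)` is a limit in `L²` of pairs `(f, ∇ f)` with `f ∈ C_c^2(E)`. -/
structure HasGradient (s : ℝ) (ϱ : Orthant n → ℝ) (u : Orthant n → ℝ)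
    (h : Fin n → Orthant n → ℝ) : Prop where
  memLp : MemLp u 2 (refMeasure s ϱ)
  memLp_grad : ∀ i, MemLp (h i) 2 (partMeasure s ϱ i)
  approx : ∀ ε > (0 : ℝ≥0∞), ∃ f : Orthant n → ℝ, IsC2c f ∧
    eLpNorm (f - u) 2 (refMeasure s ϱ) < ε ∧
    ∀ i, eLpNorm (pderiv i f - h i) 2 (partMeasure s ϱ i) < ε

lemma HasGradient.exists_seq {u : Orthant n → ℝ} {h : Fin n → Orthant n → ℝ}
    (H : HasGradient s ϱ u h) : ∃ f : ℕ → Orthant n → ℝ, (∀ k, IsC2c (f k)) ∧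
      Tendsto (fun k => eLpNorm (f k - u) 2 (refMeasure s ϱ)) atTop (𝓝 0) ∧
      ∀ i, Tendsto (fun k => eLpNorm (pderiv i (f k) - h i) 2 (partMeasure s ϱ i)) atTop
        (𝓝 0) := by
  obtain ⟨ε, -, hεp, hε⟩ := exists_seq_strictAnti_tendsto' (zero_lt_one' ℝ≥0∞)
  choose f hf h1 h2 using fun k => H.approx (ε k) (hεp k).1
  refine ⟨f, hf, ?_, fun i => ?_⟩
  · exact tendsto_of_tendsto_of_tendsto_of_le_of_le tendsto_const_nhds hε (fun _ => zero_le)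
      fun k => (h1 k).le
  · exact tendsto_of_tendsto_of_tendsto_of_le_of_le tendsto_const_nhds hε (fun _ => zero_le)
      fun k => (h2 k i).le

lemma HasGradient.congr {u u' : Orthant n → ℝ} {h h' : Fin n → Orthant n → ℝ}
    (H : HasGradient s ϱ u h) (hu : u =ᵐ[refMeasure s ϱ] u')
    (hh : ∀ i, h i =ᵐ[partMeasure s ϱ i] h' i) : HasGradient s ϱ u' h' where
  memLp := (memLp_congr_ae hu).1 H.memLp
  memLp_grad i := (memLp_congr_ae (hh i)).1 (H.memLp_grad i)
  approx ε hε := by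
    obtain ⟨f, hf, h1, h2⟩ := H.approx ε hε
    refine ⟨f, hf, ?_, fun i => ?_⟩
    · rwa [← eLpNorm_congr_ae (EventuallyEq.rfl.sub hu)]
    · rw [← eLpNorm_congr_ae (EventuallyEq.rfl.sub (hh i))]
      exact h2 i

/-- The relation is closed under L² limits; both chain rules are obtained by two successive passages
to the limit. -/
lemma HasGradient.of_tendsto {u : ℕ → Orthant n → ℝ} {h : ℕ → Fin n → Orthant n → ℝ}
    (H : ∀ k, HasGradient s ϱ (u k) (h k)) {v : Orthant n → ℝ} {g : Fin n → Orthant n → ℝ}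
    (hv : MemLp v 2 (refMeasure s ϱ)) (hg : ∀ i, MemLp (g i) 2 (partMeasure s ϱ i))
    (huv : Tendsto (fun k => eLpNorm (u k - v) 2 (refMeasure s ϱ)) atTop (𝓝 0))
    (hhg : ∀ i, Tendsto (fun k => eLpNorm (h k i - g i) 2 (partMeasure s ϱ i)) atTop (𝓝 0)) :
    HasGradient s ϱ v g where
  memLp := hv
  memLp_grad := hg
  approx ε hε := by
    have hε2 : 0 < ε / 2 := ENNReal.half_pos hε.ne'
    obtain ⟨k, hk1, hk2⟩ := ((huv.eventually_lt_const hε2).and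
      (eventually_all.2 fun i => (hhg i).eventually_lt_const hε2)).exists
    obtain ⟨f, hf, h1, h2⟩ := (H k).approx (ε / 2) hε2
    refine ⟨f, hf, ?_, fun i => ?_⟩
    · calc eLpNorm (f - v) 2 (refMeasure s ϱ)
          = eLpNorm ((f - u k) + (u k - v)) 2 (refMeasure s ϱ) := by simp
        _ ≤ eLpNorm (f - u k) 2 (refMeasure s ϱ) + eLpNorm (u k - v) 2 (refMeasure s ϱ) :=
            eLpNorm_add_le (hf.cont.aestronglyMeasurable.sub (H k).memLp.1)
              ((H k).memLp.1.sub hv.1) one_le_two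
        _ < ε / 2 + ε / 2 := ENNReal.add_lt_add h1 hk1
        _ = ε := ENNReal.add_halves ε
    · calc eLpNorm (pderiv i f - g i) 2 (partMeasure s ϱ i)
          = eLpNorm ((pderiv i f - h k i) + (h k i - g i)) 2 (partMeasure s ϱ i) := by simp
        _ ≤ eLpNorm (pderiv i f - h k i) 2 (partMeasure s ϱ i) +
              eLpNorm (h k i - g i) 2 (partMeasure s ϱ i) :=
            eLpNorm_add_le ((hf.continuous_pderiv i).aestronglyMeasurable.sub
              ((H k).memLp_grad i).1) (((H k).memLp_grad i).1.sub (hg i).1) one_le_two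
        _ < ε / 2 + ε / 2 := ENNReal.add_lt_add (h2 i) (hk2 i)
        _ = ε := ENNReal.add_halves ε

lemma IsC2c.hasGradient [IsFiniteMeasure (refMeasure s ϱ)] {f : Orthant n → ℝ} (hf : IsC2c f) :
    HasGradient s ϱ f fun i => pderiv i f where
  memLp := hf.memLp _
  memLp_grad i := by
    unfold partMeasure
    exact hf.memLp_pderiv i _
  approx ε hε := ⟨f, hf, by simpa using hε, fun i => by simpa using hε⟩

lemma memLp_mul_of_abs_le_one {X : Type*} [MeasurableSpace X] {μ : Measure X} {a h : X → ℝ}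
    (ha : AEStronglyMeasurable a μ) (ha1 : ∀ᵐ x ∂μ, |a x| ≤ 1) (hh : MemLp h 2 μ) :
    MemLp (fun x => a x * h x) 2 μ := by
  refine hh.of_le (ha.mul hh.1) ?_
  filter_upwards [ha1] with x hx
  rw [norm_mul]
  exact mul_le_of_le_one_left (norm_nonneg _) hx

/-- The chain rule for smooth contractions. -/
lemma HasGradient.comp_primitive [IsFiniteMeasure (refMeasure s ϱ)] {u : Orthant n → ℝ}
    {h : Fin n → Orthant n → ℝ} (H : HasGradient s ϱ u h) {ψ : ℝ → ℝ} (hψ : ContDiff ℝ 1 ψ)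
    (h1 : ∀ t, |ψ t| ≤ 1) :
    HasGradient s ϱ (fun x => primitive ψ (u x)) fun i x => ψ (u x) * h i x := by
  obtain ⟨f, hf, hfu, hfh⟩ := H.exists_seq
  -- The factor ψ(fₖ) must converge pointwise, so a subsequence converging a.e. is needed.
  obtain ⟨ns, hns, hae⟩ := (tendstoInMeasure_of_tendsto_eLpNorm two_ne_zero
    (fun k => (hf k).cont.aestronglyMeasurable) H.memLp.1 hfu).exists_seq_tendsto_ae
  have hc2 := contDiff_primitive hψ
  have hψu : AEStronglyMeasurable (fun x => ψ (u x)) (refMeasure s ϱ) :=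
    hψ.continuous.comp_aestronglyMeasurable H.memLp.1
  refine HasGradient.of_tendsto
    (fun k => ((hf (ns k)).comp hc2 (primitive_zero ψ)).hasGradient) ?_ ?_ ?_ ?_
  · refine H.memLp.of_le (hc2.continuous.comp_aestronglyMeasurable H.memLp.1)
      (ae_of_all _ fun x => abs_primitive_le hψ.continuous h1 _)
  · exact fun i => memLp_mul_of_abs_le_one hψu.restrict (ae_of_all _ fun x => h1 _)
      (H.memLp_grad i)
  · refine tendsto_of_tendsto_of_tendsto_of_le_of_le tendsto_const_nhds
      (hfu.comp hns.tendsto_atTop) (fun _ => zero_le) fun k => ?_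
    exact eLpNorm_mono fun x => abs_primitive_sub_le hψ.continuous h1 _ _
  · intro i
    have hpd : ∀ k, pderiv i (primitive ψ ∘ f (ns k)) =
        fun x => ψ (f (ns k) x) * pderiv i (f (ns k)) x := fun k => by
      rw [pderiv_comp (hf _) (hc2.of_le one_le_two) (primitive_zero ψ),
        deriv_primitive hψ.continuous]
    simp_rw [hpd]
    refine tendsto_eLpNorm_mul_sub
      (fun k => (hψ.continuous.comp (hf _).cont).aestronglyMeasurable) (fun k x => h1 _) ?_
      (fun k => ((hf _).continuous_pderiv i).aestronglyMeasurable) (H.memLp_grad i)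
      ((hfh i).comp hns.tendsto_atTop)
    refine ae_restrict_of_ae ?_
    filter_upwards [hae] with x hx
    exact (hψ.continuous.tendsto _).comp hx

/-- The chain rule for primitives of pointwise limits of smooth functions. -/
lemma HasGradient.comp_primitive_of_tendsto [IsFiniteMeasure (refMeasure s ϱ)]
    {u : Orthant n → ℝ} {h : Fin n → Orthant n → ℝ} (H : HasGradient s ϱ u h) {ψ : ℕ → ℝ → ℝ}
    (hψ : ∀ k, ContDiff ℝ 1 (ψ k)) (h1 : ∀ k t, |ψ k t| ≤ 1) {χ : ℝ → ℝ}
    (hχ : ∀ t, Tendsto (fun k => ψ k t) atTop (𝓝 (χ t))) :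
    HasGradient s ϱ (fun x => primitive χ (u x)) fun i x => χ (u x) * h i x := by
  have hψu : ∀ k, AEStronglyMeasurable (fun x => ψ k (u x)) (refMeasure s ϱ) := fun k =>
    (hψ k).continuous.comp_aestronglyMeasurable H.memLp.1
  have hχu : AEStronglyMeasurable (fun x => χ (u x)) (refMeasure s ϱ) :=
    aestronglyMeasurable_of_tendsto_ae atTop hψu (ae_of_all _ fun x => hχ (u x))
  have hχ1 : ∀ t, |χ t| ≤ 1 := fun t =>
    le_of_tendsto (hχ t).abs (Eventually.of_forall fun k => h1 k t)
  have hlim : ∀ t, Tendsto (fun k => primitive (ψ k) t) atTop (𝓝 (primitive χ t)) :=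
    tendsto_primitive (fun k => (hψ k).continuous) h1 hχ
  have hpu : ∀ k, AEStronglyMeasurable (fun x => primitive (ψ k) (u x)) (refMeasure s ϱ) :=
    fun k => (contDiff_primitive (hψ k)).continuous.comp_aestronglyMeasurable H.memLp.1
  have hpχ : AEStronglyMeasurable (fun x => primitive χ (u x)) (refMeasure s ϱ) :=
    aestronglyMeasurable_of_tendsto_ae atTop hpu (ae_of_all _ fun x => hlim (u x))
  have hle : ∀ t, |primitive χ t| ≤ |t| := fun t =>
    le_of_tendsto (hlim t).abs (Eventually.of_forall fun k =>
      abs_primitive_le (hψ k).continuous (h1 k) t)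
  refine HasGradient.of_tendsto (fun k => H.comp_primitive (hψ k) (h1 k)) ?_ ?_ ?_ ?_
  · exact H.memLp.of_le hpχ (ae_of_all _ fun x => hle _)
  · exact fun i => memLp_mul_of_abs_le_one hχu.restrict (ae_of_all _ fun x => hχ1 _)
      (H.memLp_grad i)
  · refine tendsto_eLpNorm_zero_of_dominated (fun k => (hpu k).sub hpχ)
      (H.memLp.const_mul 2) (fun k => ae_of_all _ fun x => ?_) (ae_of_all _ fun x => ?_)
    · rw [norm_mul, Real.norm_eq_abs, Real.norm_eq_abs, Real.norm_eq_abs, abs_two]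
      refine (abs_sub _ _).trans ?_
      linarith [hle (u x), abs_primitive_le (hψ k).continuous (h1 k) (u x)]
    · simpa using (hlim (u x)).sub_const (primitive χ (u x))
  · intro i
    refine tendsto_eLpNorm_mul_sub (fun k => (hψu k).restrict) (fun k x => h1 _ _)
      (ae_of_all _ fun x => hχ (u x)) (fun k => (H.memLp_grad i).1) (H.memLp_grad i) ?_
    simp

lemma primitive_indicator_Ioo (t : ℝ) :
    primitive ((Set.Ioo 0 1).indicator 1) t = min (max t 0) 1 := by
  rw [primitive]
  rcases le_total 0 t with ht | ht
  · rw [intervalIntegral.integral_of_le ht, integral_indicator_one measurableSet_Ioo,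
      measureReal_restrict_apply measurableSet_Ioo, max_eq_left ht]
    have : (Set.Ioo (0 : ℝ) 1 ∩ Set.Ioc 0 t : Set ℝ) =ᵐ[volume] Set.Ioc 0 (min t 1) := by
      have h1 : Set.Ioc (0 : ℝ) 1 ∩ Set.Ioc 0 t = Set.Ioc 0 (min t 1) := by
        rw [Set.Ioc_inter_Ioc]
        simp [min_comm]
      rw [← h1]
      exact ae_eq_set_inter Ioo_ae_eq_Ioc (ae_eq_refl _)
    rw [measureReal_congr this, Real.volume_real_Ioc_of_le (by positivity)]
    simp
  · rw [intervalIntegral.integral_of_ge ht, max_eq_right ht, setIntegral_eq_zero_of_forall_eq_zero]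
    · simp
    · intro x hx
      exact Set.indicator_of_notMem (fun h => absurd hx.2 (not_le.2 h.1)) _

/-- Combined with the chain rule, this makes 1_{u=c} h a gradient of the zero function. -/
lemma primitive_indicator_singleton (c t : ℝ) : primitive (({c} : Set ℝ).indicator 1) t = 0 := by
  rw [primitive]
  refine intervalIntegral.integral_zero_ae ?_
  have : ∀ᵐ x : ℝ, x ≠ c := compl_mem_ae_iff.2 (measure_singleton c)
  filter_upwards [this] with x hx _
  simp [hx]

lemma smoothTransition_abs_le (t : ℝ) : |Real.smoothTransition t| ≤ 1 := by
  rw [abs_of_nonneg (Real.smoothTransition.nonneg t)]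
  exact Real.smoothTransition.le_one t

lemma tendsto_smoothTransition_nat_mul (a : ℝ) :
    Tendsto (fun k : ℕ => Real.smoothTransition (k * a)) atTop (𝓝 (if 0 < a then 1 else 0)) := by
  split_ifs with ha
  · refine tendsto_const_nhds.congr' ?_
    filter_upwards [(tendsto_natCast_atTop_atTop.atTop_mul_const ha).eventually_ge_atTop (1 : ℝ)]
      with k hk
    exact (Real.smoothTransition.one_of_one_le hk).symm
  · refine tendsto_const_nhds.congr fun k => ?_
    refine (Real.smoothTransition.zero_of_nonpos ?_).symm
    exact mul_nonpos_of_nonneg_of_nonpos (Nat.cast_nonneg k) (not_lt.1 ha)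

/-- The unit contraction operates. -/
lemma HasGradient.unitContraction [IsFiniteMeasure (refMeasure s ϱ)] {u : Orthant n → ℝ}
    {h : Fin n → Orthant n → ℝ} (H : HasGradient s ϱ u h) :
    HasGradient s ϱ (fun x => min (max (u x) 0) 1)
      fun i x => (Set.Ioo 0 1).indicator 1 (u x) * h i x := by
  have hsm : ContDiff ℝ 1 Real.smoothTransition := Real.smoothTransition.contDiff
  have := H.comp_primitive_of_tendsto
    (ψ := fun k t => Real.smoothTransition (k * t) * Real.smoothTransition (k * (1 - t)))
    (χ := (Set.Ioo 0 1).indicator 1)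
    (fun k => (hsm.comp (by fun_prop)).mul (hsm.comp (by fun_prop)))
    (fun k t => by
      rw [abs_mul]
      exact mul_le_one₀ (smoothTransition_abs_le _) (abs_nonneg _) (smoothTransition_abs_le _))
    (fun t => by
      have h1 := (tendsto_smoothTransition_nat_mul t).mul
        (tendsto_smoothTransition_nat_mul (1 - t))
      convert h1 using 2
      by_cases h0 : 0 < t <;> by_cases h2 : t < 1 <;> simp [Set.indicator, h0, h2])
  simpa only [primitive_indicator_Ioo] using this

/-- Single-valuedness of the closed gradient at the level of functions; the Hamza condition enters
through `ae_partMeasure_eq_zero`. -/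
lemma HasGradient.ae_eq_zero (hs : 0 < s) (hpos : ∀ᵐ x ∂baseMeasure n s, 0 < ϱ x)
    (hint : Integrable ϱ (baseMeasure n s)) (hHamza : HamzaCondition s ϱ) {u : Orthant n → ℝ}
    {h : Fin n → Orthant n → ℝ} (H : HasGradient s ϱ u h) (hu : u =ᵐ[refMeasure s ϱ] 0)
    (i : Fin n) : h i =ᵐ[partMeasure s ϱ i] 0 := by
  obtain ⟨f, hf, hfu, hfh⟩ := (H.congr hu fun i => EventuallyEq.rfl).exists_seq
  exact ae_partMeasure_eq_zero hs hpos hint hHamza hf (H.memLp_grad i) (by simpa using hfu)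
    (hfh i)

/-- The gradient vanishes almost everywhere on level sets. -/
lemma HasGradient.ae_eq_zero_of_eq (hs : 0 < s) (hpos : ∀ᵐ x ∂baseMeasure n s, 0 < ϱ x)
    (hint : Integrable ϱ (baseMeasure n s)) (hHamza : HamzaCondition s ϱ) {u : Orthant n → ℝ}
    {h : Fin n → Orthant n → ℝ} (H : HasGradient s ϱ u h) (c : ℝ) (i : Fin n) :
    ∀ᵐ x ∂partMeasure s ϱ i, u x = c → h i x = 0 := by
  have := isFiniteMeasure_refMeasure hint
  have hsm : ContDiff ℝ 1 Real.smoothTransition := Real.smoothTransition.contDiff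
  -- The approximants equal 1 at `c` and tend to 0 elsewhere; the square makes them C¹ and
  -- two-sided.
  have H' := H.comp_primitive_of_tendsto
    (ψ := fun k t => 1 - Real.smoothTransition (k * (t - c) ^ 2))
    (χ := ({c} : Set ℝ).indicator 1)
    (fun k => contDiff_const.sub (hsm.comp (by fun_prop)))
    (fun k t => by
      rw [abs_of_nonneg (sub_nonneg.2 (Real.smoothTransition.le_one _))]
      linarith [Real.smoothTransition.nonneg (k * (t - c) ^ 2)])
    (fun t => by
      have h1 := (tendsto_smoothTransition_nat_mul ((t - c) ^ 2)).const_sub 1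
      convert h1 using 2
      by_cases h0 : t = c
      · simp [h0]
      · have : 0 < (t - c) ^ 2 := by
          have := sub_ne_zero.2 h0
          positivity
        simp [h0, this])
  filter_upwards [H'.ae_eq_zero hs hpos hint hHamza
    (ae_of_all _ fun x => primitive_indicator_singleton c (u x)) i] with x hx hxc
  simpa [hxc] using hx

end Orthant


/-! ### The gradient graph and the Dirichlet form properties of its closure. -/

namespace Orthant

variable {n : ℕ} {s : ℝ} {ϱ : Orthant n → ℝ}

/-- The Hilbert space in which gradients take their values. -/
abbrev GradSpace (s : ℝ) (ϱ : Orthant n → ℝ) : Type :=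
  PiLp 2 fun i : Fin n => Lp ℝ 2 (partMeasure s ϱ i)

/-- The graph of the gradient on `C_c^2(E)`. -/
def gradGraph (s : ℝ) (ϱ : Orthant n → ℝ) :
    Submodule ℝ (Lp ℝ 2 (refMeasure s ϱ) × GradSpace s ϱ) where
  carrier := {p | ∃ f : Orthant n → ℝ, IsC2c f ∧ p.1 =ᵐ[refMeasure s ϱ] f ∧
    ∀ i, p.2 i =ᵐ[partMeasure s ϱ i] pderiv i f}
  zero_mem' := by
    refine ⟨0, IsC2c.zero, Lp.coeFn_zero _ _ _, fun i => ?_⟩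
    have : pderiv i (0 : Orthant n → ℝ) = 0 := by
      simpa using pderiv_smul (IsC2c.zero (n := n)) 0 i
    rw [this]
    exact Lp.coeFn_zero _ _ _
  add_mem' := by
    rintro p q ⟨f, hf, h1, h2⟩ ⟨g, hg, h3, h4⟩
    refine ⟨f + g, hf.add hg, (Lp.coeFn_add _ _).trans (h1.add h3), fun i => ?_⟩
    rw [pderiv_add hf hg]
    exact (Lp.coeFn_add _ _).trans ((h2 i).add (h4 i))
  smul_mem' := by
    rintro c p ⟨f, hf, h1, h2⟩
    refine ⟨c • f, hf.smul c, (Lp.coeFn_smul _ _).trans (h1.const_smul c), fun i => ?_⟩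
    rw [pderiv_smul hf]
    exact (Lp.coeFn_smul _ _).trans ((h2 i).const_smul c)

instance [IsFiniteMeasure (refMeasure s ϱ)] (i : Fin n) : IsFiniteMeasure (partMeasure s ϱ i) := by
  unfold partMeasure
  infer_instance

/-- The gradient of a function in `C_c^2(E)`, as an element of the Hilbert space. -/
def gradLp [IsFiniteMeasure (refMeasure s ϱ)] {f : Orthant n → ℝ} (hf : IsC2c f) :
    GradSpace s ϱ :=
  WithLp.toLp 2 fun i => (hf.memLp_pderiv i (partMeasure s ϱ i)).toLp

lemma mk_mem_gradGraph [IsFiniteMeasure (refMeasure s ϱ)] {f : Orthant n → ℝ} (hf : IsC2c f)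
    {u : Lp ℝ 2 (refMeasure s ϱ)} (hu : u =ᵐ[refMeasure s ϱ] f) :
    (u, gradLp hf) ∈ gradGraph s ϱ :=
  ⟨f, hf, hu, fun i => (hf.memLp_pderiv i (partMeasure s ϱ i)).coeFn_toLp⟩

/-- Dictionary between closure in the product Hilbert space and the function-level relation, in
which the chain rule is available. -/
lemma mem_closure_gradGraph [IsFiniteMeasure (refMeasure s ϱ)]
    {p : Lp ℝ 2 (refMeasure s ϱ) × GradSpace s ϱ} :
    p ∈ (gradGraph s ϱ).topologicalClosure ↔ HasGradient s ϱ p.1 fun i => p.2 i := by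
  constructor
  · intro hp
    refine ⟨Lp.memLp _, fun i => Lp.memLp _, fun ε hε => ?_⟩
    have hcl : p ∈ closure (gradGraph s ϱ : Set (Lp ℝ 2 (refMeasure s ϱ) × GradSpace s ϱ)) := hp
    obtain ⟨q, ⟨f, hf, h1, h2⟩, hq⟩ := EMetric.mem_closure_iff.1 hcl ε hε
    rw [Prod.edist_eq, max_lt_iff] at hq
    refine ⟨f, hf, ?_, fun i => ?_⟩
    · rw [← eLpNorm_congr_ae (h1.sub EventuallyEq.rfl), ← Lp.edist_def, edist_comm]
      exact hq.1
    · rw [← eLpNorm_congr_ae ((h2 i).sub EventuallyEq.rfl), ← Lp.edist_def, edist_comm]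
      exact (PiLp.edist_apply_le p.2 q.2 i).trans_lt hq.2
  · intro H
    obtain ⟨f, hf, h1, h2⟩ := H.exists_seq
    have hlim : Tendsto (fun k => (((hf k).memLp (refMeasure s ϱ)).toLp, gradLp (hf k))) atTop
        (𝓝 (p.1, p.2)) := by
      refine Tendsto.prodMk_nhds ?_ ?_
      · rw [tendsto_iff_edist_tendsto_0]
        refine h1.congr fun k => ?_
        rw [Lp.edist_def]
        exact (eLpNorm_congr_ae (((hf k).memLp _).coeFn_toLp.sub EventuallyEq.rfl)).symm
      · refine ((PiLp.continuous_toLp 2 _).tendsto (WithLp.ofLp p.2)).comp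
          (tendsto_pi_nhds.2 fun i => ?_)
        rw [tendsto_iff_edist_tendsto_0]
        refine (h2 i).congr fun k => ?_
        rw [Lp.edist_def]
        exact (eLpNorm_congr_ae (((hf k).memLp_pderiv i _).coeFn_toLp.sub EventuallyEq.rfl)).symm
    exact mem_closure_of_tendsto hlim (Eventually.of_forall fun k =>
      mk_mem_gradGraph (hf k) ((hf k).memLp _).coeFn_toLp)

lemma isSingleValued_closure_gradGraph (hs : 0 < s) (hpos : ∀ᵐ x ∂baseMeasure n s, 0 < ϱ x)
    (hint : Integrable ϱ (baseMeasure n s)) (hHamza : HamzaCondition s ϱ) :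
    PartialForm.IsSingleValued (gradGraph s ϱ).topologicalClosure := by
  have := isFiniteMeasure_refMeasure hint
  intro p hp hp0
  have H := mem_closure_gradGraph.1 hp
  have h0 : p.1 =ᵐ[refMeasure s ϱ] 0 := by
    rw [hp0]
    exact Lp.coeFn_zero _ _ _
  ext1 i
  exact (Lp.eq_zero_iff_ae_eq_zero).2 (H.ae_eq_zero hs hpos hint hHamza h0 i)

lemma inner_gradSpace (h k : GradSpace s ϱ) :
    inner ℝ h k = ∑ i, ∫ x, h i x * k i x ∂partMeasure s ϱ i := by
  rw [PiLp.inner_apply]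
  refine Finset.sum_congr rfl fun i _ => ?_
  rw [L2.inner_def]
  simp [mul_comm]

lemma isEnergyForm_ofGraph (hint : Integrable ϱ (baseMeasure n s))
    (hsv : PartialForm.IsSingleValued (gradGraph s ϱ)) :
    IsEnergyForm s ϱ (PartialForm.ofGraph (gradGraph s ϱ)) := by
  have := isFiniteMeasure_refMeasure hint
  refine ⟨fun f hf => hf.memLp _, fun u => ?_, fun f g hf hg B i _ => ?_,
    fun u v f g hf hg hu hv => ?_⟩
  · rw [PartialForm.mem_dom_ofGraph]
    constructor
    · rintro ⟨h, f, hf, h1, -⟩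
      exact ⟨f, hf, h1⟩
    · rintro ⟨f, hf, h1⟩
      exact ⟨_, mk_mem_gradGraph hf h1⟩
  · rw [IntegrableOn, ← refMeasure_restrict_face]
    exact hf.integrable_pderiv_mul hg i _
  · rw [hsv.form_eq u v (mk_mem_gradGraph hf hu) (mk_mem_gradGraph hg hv), inner_gradSpace,
      energy_eq hint hf hg]
    refine Finset.sum_congr rfl fun i _ => integral_congr_ae ?_
    exact (hf.memLp_pderiv i (partMeasure s ϱ i)).coeFn_toLp.mul
      (hg.memLp_pderiv i (partMeasure s ϱ i)).coeFn_toLp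

/-- Smooth compactly supported functions on ℝⁿ are dense in L² of the pushed-forward measure, and
their restrictions to the orthant lie in C_c²(E). -/
lemma dense_dom_ofGraph [IsFiniteMeasure (refMeasure s ϱ)] :
    (PartialForm.ofGraph (gradGraph s ϱ)).IsDenselyDefined := by
  intro u
  refine EMetric.mem_closure_iff.2 fun ε hε => ?_
  have hmap : MemLp ((u : Orthant n → ℝ) ∘ proj) 2 ((refMeasure s ϱ).map Subtype.val) := by
    rw [measurableEmbedding_val.memLp_map_measure_iff]
    convert Lp.memLp u using 1
    ext x
    simp
  obtain ⟨δ, hδ0, hδ⟩ := ENNReal.lt_iff_exists_nnreal_btwn.1 hε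
  obtain ⟨g, hgs, hgc, hg⟩ := hmap.exist_eLpNorm_sub_le ENNReal.ofNat_ne_top one_le_two
    (ε := δ) (by exact_mod_cast hδ0)
  have hgC : IsC2c fun x : Orthant n => g x.1 :=
    isC2c_restrict (contDiff_infty.1 hgc 2) hgs
  refine ⟨(hgC.memLp (refMeasure s ϱ)).toLp, ?_, ?_⟩
  · exact PartialForm.mem_dom_ofGraph.2
      ⟨_, mk_mem_gradGraph hgC (hgC.memLp (refMeasure s ϱ)).coeFn_toLp⟩
  · rw [Lp.edist_def, eLpNorm_congr_ae (EventuallyEq.rfl.sub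
      (hgC.memLp (refMeasure s ϱ)).coeFn_toLp)]
    rw [measurableEmbedding_val.eLpNorm_map_measure, ENNReal.ofReal_coe_nnreal] at hg
    refine lt_of_le_of_lt ?_ hδ
    refine le_trans (le_of_eq (congrArg (fun w => eLpNorm w 2 (refMeasure s ϱ)) ?_)) hg
    ext x
    simp

/-- `C_c^2(E)` is uniformly dense in `C_c(E)`. -/
lemma exists_isC2c_near {f : Orthant n → ℝ} (hf : Continuous f) (hs : HasCompactSupport f) {ε : ℝ}
    (hε : 0 < ε) : ∃ g : Orthant n → ℝ, IsC2c g ∧ ∀ x, |f x - g x| < ε := by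
  -- Extending `f` by reflection keeps the support compact; extending by `proj` would make it
  -- constant along unbounded directions.
  set a : (Fin n → ℝ) → Orthant n := fun x => ⟨fun i => |x i|, fun i => abs_nonneg _⟩ with ha
  have hac : Continuous a := by
    rw [ha]
    fun_prop
  have hFs : HasCompactSupport (f ∘ a) := by
    obtain ⟨R, hR⟩ := (hs.isCompact.image continuous_subtype_val).isBounded.subset_closedBall 0
    refine HasCompactSupport.intro (isCompact_closedBall (0 : Fin n → ℝ) R) fun x hx => ?_
    refine image_eq_zero_of_notMem_tsupport (f := f) (x := a x) fun hm => hx ?_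
    have h1 := hR (Set.mem_image_of_mem _ hm)
    rw [mem_closedBall_zero_iff] at h1 ⊢
    have hR0 : 0 ≤ R := (norm_nonneg _).trans h1
    refine (pi_norm_le_iff_of_nonneg hR0).2 fun i => ?_
    have := (norm_le_pi_norm _ i).trans h1
    simpa [ha] using this
  obtain ⟨g, hg1, hg2, hg3⟩ := (hf.comp hac).exists_contDiff_approx ⊤ (ε := fun _ => ε)
    (by fun_prop) (fun _ => hε)
  refine ⟨fun x => g x.1, isC2c_restrict (contDiff_infty.1 hg1 2)
    (hFs.mono hg3), fun x => ?_⟩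
  have h1 := hg2 x.1
  have h2 : a x.1 = x := by
    ext i
    simp [ha, abs_of_nonneg (x.2 i)]
  rw [Function.comp_apply, h2, Real.dist_eq, abs_sub_comm] at h1
  exact h1

/-- The constant function `1` is in the domain of the closure and has vanishing gradient. -/
lemma hasGradient_one [IsFiniteMeasure (refMeasure s ϱ)] :
    HasGradient s ϱ (fun _ : Orthant n => (1 : ℝ)) fun _ _ => 0 := by
  -- The cutoffs are β(cₖ x) with cₖ = 1/(k+1). They converge pointwise to 1, their gradients are at
  -- most cₖ C, and finiteness of μ makes constants square-integrable dominating functions.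
  let β : ContDiffBump (0 : Fin n → ℝ) := ⟨1, 2, one_pos, one_lt_two⟩
  have hβ : ContDiff ℝ 2 β := β.contDiff
  have hd : HasCompactSupport (fderiv ℝ β) := β.hasCompactSupport.fderiv ℝ
  obtain ⟨C, hC⟩ := hd.exists_bound_of_continuous (hβ.continuous_fderiv two_ne_zero)
  set c : ℕ → ℝ := fun k => 1 / ((k : ℝ) + 1) with hc
  have hc0 : ∀ k, 0 < c k := fun k => by
    rw [hc]
    positivity
  have hc1 : ∀ k, c k ≤ 1 := fun k => by
    rw [hc, div_le_one (by positivity)]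
    simp
  have hct : Tendsto c atTop (𝓝 0) := tendsto_one_div_add_atTop_nhds_zero_nat
  have hCD : ∀ k, ContDiff ℝ 2 fun y : Fin n → ℝ => β (c k • y) := fun k =>
    hβ.comp (contDiff_const_smul _)
  have hf : ∀ k, IsC2c fun x : Orthant n => β (c k • x.1) := fun k => by
    refine isC2c_restrict (G := fun y => β (c k • y)) (hCD k) ?_
    exact β.hasCompactSupport.comp_smul (hc0 k).ne'
  have hpd : ∀ k i, pderiv i (fun x : Orthant n => β (c k • x.1)) =
      fun x => c k * fderiv ℝ β (c k • x.1) (Pi.single i 1) := fun k i => by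
    rw [pderiv_restrict (G := fun y => β (c k • y)) ((hCD k).of_le one_le_two)]
    ext x
    have h1 : HasFDerivAt (fun y : Fin n → ℝ => β (c k • y))
        ((fderiv ℝ β (c k • x.1)).comp (c k • ContinuousLinearMap.id ℝ (Fin n → ℝ))) x.1 :=
      HasFDerivAt.comp (g := β) (f := fun y => c k • y) x.1
        (hβ.differentiable two_ne_zero _).hasFDerivAt
        ((hasFDerivAt_id x.1).const_smul (c k))
    rw [h1.fderiv]
    simp
  have hbd : ∀ k (i : Fin n) (x : Orthant n),
      ‖c k * fderiv ℝ β (c k • x.1) (Pi.single i 1)‖ ≤ c k * C := fun k i x => by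
    rw [norm_mul, Real.norm_of_nonneg (hc0 k).le]
    refine mul_le_mul_of_nonneg_left ?_ (hc0 k).le
    refine ((fderiv ℝ β (c k • x.1)).le_opNorm _).trans ?_
    have : ‖(Pi.single i 1 : Fin n → ℝ)‖ ≤ 1 :=
      (pi_norm_le_iff_of_nonneg zero_le_one).2 fun j => by
        by_cases hj : j = i
        · subst hj; simp
        · simp [hj]
    exact (mul_le_of_le_one_right (norm_nonneg _) this).trans (hC _)
  have hC0 : 0 ≤ C := (norm_nonneg _).trans (hC 0)
  refine HasGradient.of_tendsto (fun k => (hf k).hasGradient) (memLp_const 1)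
    (fun i => memLp_const 0) ?_ fun i => ?_
  · refine tendsto_eLpNorm_zero_of_dominated (G := fun _ => 1)
      (fun k => ((hf k).cont.sub continuous_const).aestronglyMeasurable) (memLp_const 1)
      (fun k => ae_of_all _ fun x => ?_) (ae_of_all _ fun x => ?_)
    · simp only [Pi.sub_apply, norm_one, Real.norm_eq_abs]
      rw [abs_le]
      constructor <;> linarith [β.nonneg' (c k • x.1), β.le_one (x := c k • x.1)]
    · have h1 : Tendsto (fun k => c k • x.1) atTop (𝓝 0) := by
        simpa using hct.smul_const x.1
      have h2 := (β.continuous.tendsto 0).comp h1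
      have h3 : β 0 = 1 := β.one_of_mem_closedBall (by simp [β])
      rw [h3] at h2
      simpa using h2.sub_const 1
  · simp_rw [hpd]
    refine tendsto_eLpNorm_zero_of_dominated (G := fun _ => C) (fun k => ?_) (memLp_const C)
      (fun k => ae_of_all _ fun x => ?_) (ae_of_all _ fun x => ?_)
    · have := ((hf k).continuous_pderiv i).aestronglyMeasurable (μ := partMeasure s ϱ i)
      rw [hpd] at this
      exact this.sub aestronglyMeasurable_const
    · simp only [Pi.sub_apply, sub_zero]
      refine (hbd k i x).trans ?_
      rw [Real.norm_of_nonneg hC0]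
      exact mul_le_of_le_one_left hC0 (hc1 k)
    · simp only [Pi.sub_apply, sub_zero]
      refine squeeze_zero_norm (fun k => hbd k i x) ?_
      simpa using hct.mul_const C

lemma ae_eq_zero_of_notMem_lpSupport (hint : Integrable ϱ (baseMeasure n s))
    (u : Lp ℝ 2 (refMeasure s ϱ)) :
    ∀ᵐ x ∂refMeasure s ϱ, x ∉ PartialForm.lpSupport u → u x = 0 := by
  have := isFiniteMeasure_refMeasure hint
  have hm : MeasurableSet (PartialForm.lpSupport u)ᶜ :=
    Measure.isOpen_compl_support.measurableSet
  have h0 : ((refMeasure s ϱ).withDensity fun x => ‖u x‖ₑ) (PartialForm.lpSupport u)ᶜ = 0 :=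
    Measure.measure_compl_support
  rw [withDensity_apply _ hm, lintegral_eq_zero_iff' (Lp.aestronglyMeasurable u).enorm.restrict]
    at h0
  have h1 := (ae_restrict_iff' hm).1 h0
  filter_upwards [h1] with x hx hxs
  simpa using hx hxs

section Closure

variable (hs : 0 < s) (hpos : ∀ᵐ x ∂baseMeasure n s, 0 < ϱ x)
  (hint : Integrable ϱ (baseMeasure n s)) (hHamza : HamzaCondition s ϱ)

include hs hpos hint hHamza

/-- The contraction multiplies each gradient component by an indicator, so no component norm can
grow. -/
lemma isMarkovian_closure :
    (PartialForm.ofGraph (gradGraph s ϱ).topologicalClosure).IsMarkovian := by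
  have := isFiniteMeasure_refMeasure hint
  have hsv := isSingleValued_closure_gradGraph hs hpos hint hHamza
  intro u v hv
  obtain ⟨h, hh⟩ := PartialForm.exists_mem_graph u
  have H := (mem_closure_gradGraph.1 hh).unitContraction
  set k : GradSpace s ϱ := WithLp.toLp 2 fun i => (H.memLp_grad i).toLp with hk
  have hki : ∀ i, k i =ᵐ[partMeasure s ϱ i]
      fun x => (Set.Ioo 0 1).indicator 1 ((u : Lp ℝ 2 (refMeasure s ϱ)) x) * h i x :=
    fun i => (H.memLp_grad i).coeFn_toLp
  have hmem : (v, k) ∈ (gradGraph s ϱ).topologicalClosure :=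
    mem_closure_gradGraph.2 (H.congr hv.symm fun i => (hki i).symm)
  refine ⟨PartialForm.mem_dom_ofGraph.2 ⟨k, hmem⟩, ?_⟩
  rw [hsv.form_eq _ _ hmem hmem, hsv.form_eq u u hh hh, real_inner_self_eq_norm_sq,
    real_inner_self_eq_norm_sq, PiLp.norm_sq_eq_of_L2, PiLp.norm_sq_eq_of_L2]
  refine Finset.sum_le_sum fun i _ => ?_
  gcongr
  refine Lp.norm_le_norm_of_ae_le ?_
  filter_upwards [hki i] with x hx
  rw [hx, norm_mul]
  refine mul_le_of_le_one_left (norm_nonneg _) ?_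
  by_cases hm : (u : Lp ℝ 2 (refMeasure s ϱ)) x ∈ Set.Ioo (0 : ℝ) 1 <;> simp [Set.indicator, hm]

/-- The gradients have a.e. zero product: on `U` the one of `v` vanishes because v = c there, and
off `U` the one of `u` vanishes because u = 0 there. -/
lemma isStronglyLocal_closure :
    (PartialForm.ofGraph (gradGraph s ϱ).topologicalClosure).IsStronglyLocal := by
  have := isFiniteMeasure_refMeasure hint
  have hsv := isSingleValued_closure_gradGraph hs hpos hint hHamza
  rintro u v - - ⟨U, hU, hsub, c, hc⟩
  obtain ⟨h, hh⟩ := PartialForm.exists_mem_graph u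
  obtain ⟨k, hk⟩ := PartialForm.exists_mem_graph v
  rw [hsv.form_eq u v hh hk, inner_gradSpace]
  refine Finset.sum_eq_zero fun i _ => integral_eq_zero_of_ae ?_
  have hu := (mem_closure_gradGraph.1 hh).ae_eq_zero_of_eq hs hpos hint hHamza 0 i
  have hv := (mem_closure_gradGraph.1 hk).ae_eq_zero_of_eq hs hpos hint hHamza c i
  filter_upwards [hu, hv, ae_restrict_of_ae (ae_eq_zero_of_notMem_lpSupport hint u.1),
    ae_restrict_of_ae ((ae_restrict_iff' hU.measurableSet).1 hc)] with x h1 h2 h3 h4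
  by_cases hx : x ∈ U
  · simp [h2 (h4 hx)]
  · simp [h1 (h3 fun hm => hx (hsub hm))]

lemma isRegular_closure :
    (PartialForm.ofGraph (gradGraph s ϱ).topologicalClosure).IsRegular := by
  have := isFiniteMeasure_refMeasure hint
  have hsv := isSingleValued_closure_gradGraph hs hpos hint hHamza
  obtain ⟨-, hle, -, happ⟩ := PartialForm.isClosureOf_ofGraph hsv
  refine ⟨fun u ε hε => ?_, fun f hf hfs ε hε => ?_⟩
  · obtain ⟨v, hv⟩ := happ u ε hε
    obtain ⟨h, f, hf, h1, -⟩ := PartialForm.exists_mem_graph v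
    exact ⟨Submodule.inclusion hle v, ⟨f, hf.cont, hf.supp, h1⟩, hv⟩
  · obtain ⟨g, hg, hfg⟩ := exists_isC2c_near hf hfs hε
    have hgL := hg.memLp (refMeasure s ϱ)
    exact ⟨g, hg.cont, hg.supp, ⟨⟨hgL.toLp, PartialForm.mem_dom_ofGraph.2
      ⟨_, Submodule.le_topologicalClosure _ (mk_mem_gradGraph hg hgL.coeFn_toLp)⟩⟩,
      hgL.coeFn_toLp⟩, hfg⟩

/-- The class of 1 has zero gradient, so its energy against every `v` vanishes and the semigroup
fixes it. -/
lemma isConservative_closure :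
    (PartialForm.ofGraph (gradGraph s ϱ).topologicalClosure).IsConservative := by
  have := isFiniteMeasure_refMeasure hint
  have hsv := isSingleValued_closure_gradGraph hs hpos hint hHamza
  have hL : MemLp (fun _ : Orthant n => (1 : ℝ)) 2 (refMeasure s ϱ) := memLp_const 1
  have hmem : (hL.toLp, (0 : GradSpace s ϱ)) ∈ (gradGraph s ϱ).topologicalClosure :=
    mem_closure_gradGraph.2 (hasGradient_one.congr hL.coeFn_toLp.symm
      fun i => (Lp.coeFn_zero _ _ _).symm)
  refine ⟨hL.toLp, hL.coeFn_toLp, fun t _ => ?_⟩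
  refine PartialForm.isPositive_ofGraph.isSemigroupValue_self
    ⟨hL.toLp, PartialForm.mem_dom_ofGraph.2 ⟨0, hmem⟩⟩ (fun v => ?_) t
  obtain ⟨k, hk⟩ := PartialForm.exists_mem_graph v
  rw [hsv.form_eq _ v hmem hk, inner_zero_left]

end Closure

end Orthant

end

theorem mainTheorem4 (n : ℕ) (hn : 1 ≤ n) (s : ℝ) (hs : 0 < s) (ϱ : Orthant n → ℝ)
    (hpos : ∀ᵐ x ∂(Orthant.baseMeasure n s), 0 < ϱ x)
    (hint : MeasureTheory.Integrable ϱ (Orthant.baseMeasure n s))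
    (hHamza : Orthant.HamzaCondition s ϱ) :
    ∃ F : PartialForm (MeasureTheory.Lp ℝ 2 (Orthant.refMeasure s ϱ)),
      Orthant.IsEnergyForm s ϱ F ∧
      F.IsDenselyDefined ∧ F.IsSymmetric ∧ F.IsPositive ∧ F.IsClosable ∧
      ∃ G : PartialForm (MeasureTheory.Lp ℝ 2 (Orthant.refMeasure s ϱ)),
        G.IsClosureOf F ∧
        G.IsSymmetricDirichletForm ∧ G.IsRegular ∧ G.IsStronglyLocal ∧ G.IsConservative := by
  have := Orthant.isFiniteMeasure_refMeasure hint
  have hsv := Orthant.isSingleValued_closure_gradGraph hs hpos hint hHamza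
  have hcl := PartialForm.isClosureOf_ofGraph hsv
  have hdense := Orthant.dense_dom_ofGraph (s := s) (ϱ := ϱ)
  refine ⟨PartialForm.ofGraph (Orthant.gradGraph s ϱ),
    Orthant.isEnergyForm_ofGraph hint (hsv.mono (Submodule.le_topologicalClosure _)),
    hdense, PartialForm.isSymmetric_ofGraph, PartialForm.isPositive_ofGraph,
    PartialForm.isClosable_ofGraph hsv,
    PartialForm.ofGraph (Orthant.gradGraph s ϱ).topologicalClosure,
    hcl, ⟨hdense.mono hcl.2.1, PartialForm.isSymmetric_ofGraph, PartialForm.isPositive_ofGraph,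
      hcl.1, Orthant.isMarkovian_closure hs hpos hint hHamza⟩,
    Orthant.isRegular_closure hs hpos hint hHamza,
    Orthant.isStronglyLocal_closure hs hpos hint hHamza,
    Orthant.isConservative_closure hs hpos hint hHamza⟩
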